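/- Let $SU(2)$ carry its normalized Haar measure $\mu$, let $e$ be its identity matrix, and let $d(x,y)=\sqrt{\tfrac12\operatorname{tr}\big((x-y)(x-y)^*\big)}$ for $x,y\in SU(2)$. For $n\ge 0$ let $\pi_n$ be the irreducible representation of $SU(2)$ of dimension $n+1$, realized on the complex homogeneous polynomials $P$ of degree $n$ in a row vector $z=(z_0,z_1)$ by $(\pi_n(g)P)(z)=P(zg)$, and let $\chi_n=\operatorname{trace}(\pi_n)$ be its character. For $N\ge 0$ put $$\mathbf D_N=\sum_{n=0}^N (n+1)\chi_n,\qquad S_Nf(x)=(\mathbf D_N*f)(x)=\int_{SU(2)}\mathbf D_N(y)\,f(y^{-1}x)\,d\mu(y).$$ **Theorem.** Let $\alpha\in(0,1)$ and let $f:SU(2)\to\mathbb R$ be a function in $\mathrm{Lip}_\alpha(SU(2))$, that is, there is $M>0$ with $|f(x)-f(y)|\le M\,d(x,y)^\alpha$ for all $x,y\in SU(2)$. Suppose that $f$ is central, that is, for $\mu$-almost every $x\in SU(2)$, $f(yxy^{-1})=f(x)$ for all $y\in SU(2)$. Then: (a) for every open set $U\subseteq SU(2)$ containing $\{e,-e\}$,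 $S_Nf\to f$ uniformly on $SU(2)\setminus U$ as $N\to\infty$; (b) if both sequences $\{S_Nf(e)\}_{N=0}^\infty$ and $\{S_Nf(-e)\}_{N=0}^\infty$ converge, then $S_Nf\to f$ uniformly on $SU(2)$ as $N\to\infty$. -/

import Mathlib

open Filter Topology MeasureTheory

/-- The special unitary group `SU(2)`, with the topology inherited from the complex `2 × 2`
matrices. -/
abbrev SU2 : Type := Matrix.specialUnitaryGroup (Fin 2) ℂ

namespace SU2

instance : IsTopologicalGroup SU2 where
  continuous_inv := Continuous.subtype_mk (continuous_star.comp continuous_subtype_val) _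

theorem isClosed_carrier :
    IsClosed (Matrix.specialUnitaryGroup (Fin 2) ℂ : Set (Matrix (Fin 2) (Fin 2) ℂ)) := by
  have h : (Matrix.specialUnitaryGroup (Fin 2) ℂ : Set (Matrix (Fin 2) (Fin 2) ℂ)) =
      {A | A * star A = 1} ∩ {A | A.det = 1} := by
    ext A
    simp [Matrix.mem_specialUnitaryGroup_iff, Matrix.mem_unitaryGroup_iff]
  rw [h]
  refine IsClosed.inter (isClosed_eq ?_ continuous_const) (isClosed_eq ?_ continuous_const)
  · exact continuous_id.mul continuous_star
  · exact Continuous.matrix_det continuous_id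

instance : CompactSpace SU2 := by
  refine isCompact_iff_compactSpace.mp ?_
  have hK : IsCompact (Set.pi Set.univ fun _ : Fin 2 => Set.pi Set.univ fun _ : Fin 2 =>
      Metric.closedBall (0 : ℂ) 1) :=
    isCompact_univ_pi fun _ => isCompact_univ_pi fun _ => isCompact_closedBall 0 1
  refine IsCompact.of_isClosed_subset hK isClosed_carrier ?_
  intro A hA i _ j _
  simpa using entry_norm_bound_of_unitary (Matrix.specialUnitaryGroup_le_unitaryGroup hA) i j

noncomputable instance : MeasurableSpace SU2 := borel SU2

instance : BorelSpace SU2 := ⟨rfl⟩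

/-- The Haar measure on `SU(2)`, normalised to have total mass `1`. -/
noncomputable def haar : Measure SU2 :=
  Measure.haarMeasure (⊤ : TopologicalSpace.PositiveCompacts SU2)

/-- The element `-e` of `SU(2)`. -/
def negOne : SU2 :=
  ⟨-1, by
    rw [Matrix.mem_specialUnitaryGroup_iff, Matrix.mem_unitaryGroup_iff]
    constructor
    · simp
    · simp [Matrix.det_fin_two]⟩

/-- The bi-invariant metric `d(x, y) = √(½ tr((x - y)(x - y)*))` on `SU(2)`; the trace is a
nonnegative real number. -/
noncomputable def su2Dist (x y : SU2) : ℝ :=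
  Real.sqrt ((1 / 2) *
    (((x : Matrix (Fin 2) (Fin 2) ℂ) - y) * star ((x : Matrix (Fin 2) (Fin 2) ℂ) - y)).trace.re)

/-- `f ∈ Lip_α(SU(2))`. -/
def IsLip (α : ℝ) (f : SU2 → ℝ) : Prop :=
  ∃ M : ℝ, 0 < M ∧ ∀ x y : SU2, |f x - f y| ≤ M * su2Dist x y ^ α

/-- `f` is central: for almost every `x`, `f (y x y⁻¹) = f x` for all `y`. -/
def IsCentral (f : SU2 → ℝ) : Prop :=
  ∀ᵐ x ∂haar, ∀ y : SU2, f (y * x * y⁻¹) = f x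

/-- The substitution `P(z) ↦ P(z g)` on polynomials in the row vector `z = (z₀, z₁)`. -/
noncomputable def subst (g : SU2) : MvPolynomial (Fin 2) ℂ →ₐ[ℂ] MvPolynomial (Fin 2) ℂ :=
  MvPolynomial.aeval fun j => ∑ i, MvPolynomial.C (g.1 i j) * MvPolynomial.X i

theorem subst_one : subst 1 = AlgHom.id ℂ (MvPolynomial (Fin 2) ℂ) := by
  apply MvPolynomial.algHom_ext
  intro j
  fin_cases j <;> simp [subst]

theorem subst_mul (g h : SU2) : subst (g * h) = (subst g).comp (subst h) := by
  apply MvPolynomial.algHom_ext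
  intro j
  simp [subst, Matrix.mul_apply, Fin.sum_univ_two, MvPolynomial.algHom_C]
  ring

theorem subst_mem (n : ℕ) (g : SU2) :
    ∀ P ∈ MvPolynomial.homogeneousSubmodule (Fin 2) ℂ n,
      (subst g).toLinearMap P ∈ MvPolynomial.homogeneousSubmodule (Fin 2) ℂ n := by
  intro P hP
  rw [MvPolynomial.mem_homogeneousSubmodule] at hP ⊢
  have h := hP.aeval (n := 1) (S := ℂ)
    (fun j => ∑ i, MvPolynomial.C (g.1 i j) * MvPolynomial.X i)
    (fun j => MvPolynomial.IsHomogeneous.sum _ _ _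
      fun i _ => MvPolynomial.isHomogeneous_C_mul_X _ i)
  simpa [subst] using h

/-- The `(n + 1)`-dimensional irreducible representation `π_n` of `SU(2)`, acting on the
homogeneous polynomials of degree `n` in two variables by `(π_n(g) P)(z) = P(z g)`. -/
noncomputable def irrep (n : ℕ) :
    Representation ℂ SU2 (MvPolynomial.homogeneousSubmodule (Fin 2) ℂ n) where
  toFun g := (subst g).toLinearMap.restrict (subst_mem n g)
  map_one' := by
    ext1 P
    apply Subtype.ext
    simp [subst_one]
  map_mul' g h := by
    ext1 P
    apply Subtype.ext
    simp [subst_mul]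

/-- The Dirichlet kernel `D_N = ∑_{n=0}^N (n + 1) χ_n`, where `χ_n` is the character of `π_n`. -/
noncomputable def dirichletKernel (N : ℕ) (x : SU2) : ℂ :=
  ∑ n ∈ Finset.range (N + 1), ((n : ℂ) + 1) * (irrep n).character x

/-- The Fourier partial sum `S_N f = D_N * f`. -/
noncomputable def partialSum (N : ℕ) (f : SU2 → ℝ) (x : SU2) : ℂ :=
  ∫ y, dirichletKernel N y * (f (y⁻¹ * x) : ℂ) ∂haar

end SU2

/-!
The characters satisfy `χ_n = U_n (tr / 2)` with `U_n` the Chebyshev polynomial of the second kind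
(`SU2.character_eq_chebyshevU`). Schur's lemma for `π_n`, proved in the monomial basis, gives
`∫ χ_n (x h y h⁻¹) dh = χ_n(x) χ_n(y) / (n + 1)` and the vanishing of the means of the nontrivial
characters; the latter yields Weyl's integration formula (`SU2.integral_comp_halfTrace`). Hence for
a central `f`, with `F(θ) = f(diag(e^{iθ}, e^{-iθ}))`, the value of `S_N f` on the conjugacy class
of angle `θ ∈ [0, π]` is the partial sum of the expansion of `F` in the functions `U_n(cos θ)`,
which are orthogonal for the weight `sin² t` (`SU2.partialSum_conj_torus`).

By the Christoffel–Darboux identity, with `m = N + 1`, `ω = m + 1/2` and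
`g_θ(t) = (F(t) - F(θ)) sin t / (cos θ - cos t)`, the remainder at `θ` is
`(1/π) [(U_m - U_{m-1})(cos θ) A_m(θ) - (U_m + U_{m-1})(cos θ) B_m(θ)]`, where
`A_m(θ) = ∫ g_θ(t) cos(t/2) sin(ωt) dt` and `B_m(θ) = ∫ g_θ(t) sin(t/2) cos(ωt) dt` over `[0, π]`
(`chebyshevPartialSum_sub`). Since `F` is Hölder continuous, `g_θ(t) = O(|t - θ|^{α-1})`, and a
Riemann–Lebesgue lemma uniform in `θ` (`IsWeaklySingular.tendstoUniformlyOn_integral_mul_exp`)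
makes both integrals tend to `0` uniformly. As `sin θ (U_m ± U_{m-1})(cos θ)` is bounded, this
settles uniform convergence away from `θ = 0, π`.

Near `θ = 0` only the term with `U_m + U_{m-1}`, which is as large as `2m + 1`, needs care. The
difference `B_m(θ) - B_m(0)` is `2 sin(θ/2)` times an integral of the same weakly singular type
(`cosRemainder_eq`), and `sin(θ/2) (U_m + U_{m-1})(cos θ) = sin(ωθ)` is bounded, so that it remains
to see `(2m + 1) B_m(0) → 0`. Convergence of `S_N f(e)` says that `(2m + 1) B_m(0)` has a limit.
The sums `∑_{m<K} B_m(0)` are Dirichlet integrals of a Hölder function at a zero, hence bounded, and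
the divergence of the harmonic series forces the limit to be `0`
(`tendsto_mul_cosRemainder_zero`). The neighbourhood of `-e` reduces to that of `e` on translating
`f` by the central element `-e`.
-/

/-! ### The irreducible representations in coordinates -/

namespace SU2

open Polynomial.Chebyshev in
/-- The sum `∑ zⁱ wⁿ⁻ⁱ` is the Chebyshev polynomial of the second kind at `(z + w) / 2` when
`z w = 1`. -/
theorem sum_pow_mul_pow_eq_chebyshevU {z w : ℂ} (h : z * w = 1) (n : ℕ) :
    ∑ i ∈ Finset.range (n + 1), z ^ i * w ^ (n - i) = (U ℂ n).eval ((z + w) / 2) := by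
  have hrec (n : ℕ) : ∑ i ∈ Finset.range (n + 1), z ^ i * w ^ (n - i) =
      z ^ n + w * ∑ i ∈ Finset.range n, z ^ i * w ^ (n - 1 - i) := geom_sum₂_succ_eq z w
  induction n using Nat.twoStepInduction with
  | zero => simp
  | one => simp [hrec]; ring
  | more n ih₀ ih₁ =>
    have e : ((n + 2 : ℕ) : ℤ) = (n : ℤ) + 2 := by push_cast; rfl
    rw [e, U_add_two]
    simp only [Polynomial.eval_sub, Polynomial.eval_mul, Polynomial.eval_X, Polynomial.eval_ofNat]
    have e' : (n : ℤ) + 1 = ((n + 1 : ℕ) : ℤ) := by push_cast; rfl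
    rw [e', ← ih₀, ← ih₁]
    have h₁ := hrec (n + 1)
    have h₂ := hrec (n + 1 + 1)
    simp only [Nat.add_sub_cancel] at h₁ h₂
    rw [h₂, h₁]
    linear_combination (-∑ i ∈ Finset.range (n + 1), z ^ i * w ^ (n - i)) * h

/-- The exponent of the monomial `z₀ⁱ z₁ⁿ⁻ⁱ`. -/
noncomputable def homExponent (n : ℕ) (i : Fin (n + 1)) : Fin 2 →₀ ℕ :=
  Finsupp.single 0 (i : ℕ) + Finsupp.single 1 (n - i)

@[simp] theorem homExponent_zero (n : ℕ) (i : Fin (n + 1)) : homExponent n i 0 = i := by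
  simp [homExponent]

@[simp] theorem homExponent_one (n : ℕ) (i : Fin (n + 1)) : homExponent n i 1 = n - i := by
  simp [homExponent]

theorem homExponent_injective (n : ℕ) : Function.Injective (homExponent n) := fun i j h =>
  Fin.ext (by simpa using DFunLike.congr_fun h 0)

theorem degree_homExponent (n : ℕ) (i : Fin (n + 1)) : (homExponent n i).degree = n := by
  have := i.2
  simp [Finsupp.degree_eq_sum]
  omega

theorem exists_homExponent_eq {n : ℕ} {m : Fin 2 →₀ ℕ} (h : m.degree = n) :
    ∃ i, homExponent n i = m := by
  simp only [Finsupp.degree_eq_sum, Fin.sum_univ_two] at h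
  refine ⟨⟨m 0, by omega⟩, ?_⟩
  ext k
  fin_cases k
  · simp
  · simp; omega

/-- Coordinates of a binary form with respect to the monomials `z₀ⁱ z₁ⁿ⁻ⁱ`. -/
noncomputable def formCoords (n : ℕ) :
    MvPolynomial.homogeneousSubmodule (Fin 2) ℂ n ≃ₗ[ℂ] (Fin (n + 1) → ℂ) where
  toFun P i := MvPolynomial.coeff (homExponent n i) P.1
  map_add' P Q := by ext; simp
  map_smul' c P := by ext; simp
  invFun c := ⟨∑ i, MvPolynomial.monomial (homExponent n i) (c i),
    Submodule.sum_mem _ fun i _ =>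
      MvPolynomial.isHomogeneous_monomial _ (degree_homExponent n i)⟩
  left_inv P := by
    apply Subtype.ext
    ext m
    simp only [MvPolynomial.coeff_sum, MvPolynomial.coeff_monomial]
    by_cases hm : m.degree = n
    · obtain ⟨i, rfl⟩ := exists_homExponent_eq hm
      simp [(homExponent_injective n).eq_iff]
    · rw [MvPolynomial.IsHomogeneous.coeff_eq_zero P.2 hm]
      refine Finset.sum_eq_zero fun i _ => if_neg ?_
      rintro rfl
      exact hm (degree_homExponent n i)
  right_inv c := by
    ext i
    simp [MvPolynomial.coeff_sum, MvPolynomial.coeff_monomial, (homExponent_injective n).eq_iff]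

/-- The monomial basis of the binary forms of degree `n`. -/
noncomputable def formBasis (n : ℕ) :
    Module.Basis (Fin (n + 1)) ℂ (MvPolynomial.homogeneousSubmodule (Fin 2) ℂ n) :=
  Module.Basis.ofEquivFun (formCoords n)

theorem coe_formBasis (n : ℕ) (i : Fin (n + 1)) :
    (formBasis n i : MvPolynomial (Fin 2) ℂ) = MvPolynomial.monomial (homExponent n i) 1 := by
  have : ((formCoords n).symm (Pi.single i 1) : MvPolynomial (Fin 2) ℂ) =
      ∑ j, MvPolynomial.monomial (homExponent n j) ((Pi.single i 1 : Fin (n + 1) → ℂ) j) := rfl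
  rw [formBasis, Module.Basis.coe_ofEquivFun, this, Finset.sum_eq_single i]
  · simp
  · intro j _ hj
    simp [hj]
  · simp

/-- The matrix of `π_n(x)` in the monomial basis. -/
noncomputable def repMatrix (n : ℕ) (x : SU2) : Matrix (Fin (n + 1)) (Fin (n + 1)) ℂ :=
  LinearMap.toMatrix (formBasis n) (formBasis n) (irrep n x)

theorem repMatrix_mul (n : ℕ) (x y : SU2) :
    repMatrix n (x * y) = repMatrix n x * repMatrix n y := by
  rw [repMatrix, map_mul, LinearMap.toMatrix_mul]
  rfl

theorem repMatrix_one (n : ℕ) : repMatrix n 1 = 1 := by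
  rw [repMatrix, map_one, LinearMap.toMatrix_one]

theorem character_eq_trace (n : ℕ) (x : SU2) :
    (irrep n).character x = (repMatrix n x).trace :=
  LinearMap.trace_eq_matrix_trace ℂ (formBasis n) _

theorem subst_monomial (n : ℕ) (x : SU2) (j : Fin (n + 1)) :
    subst x (MvPolynomial.monomial (homExponent n j) 1) =
      (MvPolynomial.C (x.1 0 0) * MvPolynomial.X 0 +
        MvPolynomial.C (x.1 1 0) * MvPolynomial.X 1) ^ (j : ℕ) *
      (MvPolynomial.C (x.1 0 1) * MvPolynomial.X 0 +
        MvPolynomial.C (x.1 1 1) * MvPolynomial.X 1) ^ (n - j) := by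
  rw [subst, MvPolynomial.aeval_monomial, homExponent, Finsupp.prod_add_index' (by simp)
    (by intros; rw [pow_add]), Finsupp.prod_single_index (by simp),
    Finsupp.prod_single_index (by simp)]
  simp [Fin.sum_univ_two]

theorem repMatrix_apply (n : ℕ) (x : SU2) (i j : Fin (n + 1)) :
    repMatrix n x i j = MvPolynomial.coeff (homExponent n i)
      ((MvPolynomial.C (x.1 0 0) * MvPolynomial.X 0 +
        MvPolynomial.C (x.1 1 0) * MvPolynomial.X 1) ^ (j : ℕ) *
      (MvPolynomial.C (x.1 0 1) * MvPolynomial.X 0 +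
        MvPolynomial.C (x.1 1 1) * MvPolynomial.X 1) ^ (n - j)) := by
  rw [← subst_monomial, ← coe_formBasis, repMatrix, LinearMap.toMatrix_apply]
  rfl

theorem continuous_coeff_pow {X : Type*} [TopologicalSpace X] {p : X → MvPolynomial (Fin 2) ℂ}
    (hp : ∀ m, Continuous fun x => MvPolynomial.coeff m (p x)) (k : ℕ) (m : Fin 2 →₀ ℕ) :
    Continuous fun x => MvPolynomial.coeff m (p x ^ k) := by
  induction k generalizing m with
  | zero => simpa using continuous_const
  | succ k ih =>
    simp only [pow_succ, MvPolynomial.coeff_mul]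
    exact continuous_finsetSum _ fun q _ => (ih _).mul (hp _)

theorem continuous_repMatrix (n : ℕ) : Continuous (repMatrix n) := by
  have entry (i j : Fin 2) : Continuous fun x : SU2 => x.1 i j :=
    (continuous_apply_apply i j).comp continuous_subtype_val
  have lin (j : Fin 2) (m : Fin 2 →₀ ℕ) : Continuous fun x : SU2 => MvPolynomial.coeff m
      (MvPolynomial.C (x.1 0 j) * MvPolynomial.X 0 +
        MvPolynomial.C (x.1 1 j) * MvPolynomial.X 1) := by
    simp only [MvPolynomial.coeff_add, MvPolynomial.coeff_C_mul]
    exact ((entry 0 j).mul continuous_const).add ((entry 1 j).mul continuous_const)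
  refine continuous_matrix fun i j => ?_
  simp only [repMatrix_apply, MvPolynomial.coeff_mul]
  exact continuous_finsetSum _ fun q _ =>
    (continuous_coeff_pow (lin 0) _ _).mul (continuous_coeff_pow (lin 1) _ _)

/-! ### The maximal torus and conjugacy classes -/

/-- The element `diag(e^{iθ}, e^{-iθ})` of the maximal torus. -/
noncomputable def torus (θ : ℝ) : SU2 :=
  ⟨!![Complex.exp (θ * Complex.I), 0; 0, Complex.exp (-(θ * Complex.I))], by
    rw [Matrix.mem_specialUnitaryGroup_iff, Matrix.mem_unitaryGroup_iff]
    constructor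
    · ext i j
      fin_cases i <;> fin_cases j <;>
        simp [Matrix.mul_apply, Fin.sum_univ_two, Matrix.star_apply, ← Complex.exp_conj,
          ← Complex.exp_add]
    · simp [Matrix.det_fin_two, ← Complex.exp_add]⟩

theorem repMatrix_torus (n : ℕ) (θ : ℝ) :
    repMatrix n (torus θ) = Matrix.diagonal fun i : Fin (n + 1) =>
      Complex.exp (θ * Complex.I) ^ (i : ℕ) * Complex.exp (-(θ * Complex.I)) ^ (n - i : ℕ) := by
  ext i j
  rw [repMatrix_apply]
  have : (MvPolynomial.C ((torus θ).1 0 0) * MvPolynomial.X 0 +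
        MvPolynomial.C ((torus θ).1 1 0) * MvPolynomial.X 1) ^ (j : ℕ) *
      (MvPolynomial.C ((torus θ).1 0 1) * MvPolynomial.X 0 +
        MvPolynomial.C ((torus θ).1 1 1) * MvPolynomial.X 1) ^ (n - j) =
      MvPolynomial.monomial (homExponent n j) (Complex.exp (θ * Complex.I) ^ (j : ℕ) *
        Complex.exp (-(θ * Complex.I)) ^ (n - j)) := by
    rw [homExponent, ← MvPolynomial.monomial_mul, ← MvPolynomial.C_mul_X_pow_eq_monomial,
      ← MvPolynomial.C_mul_X_pow_eq_monomial]
    simp [torus, mul_pow]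
  rw [this, MvPolynomial.coeff_monomial, Matrix.diagonal_apply]
  simp only [(homExponent_injective n).eq_iff, eq_comm (a := j)]
  split_ifs with h
  · rw [h]
  · rfl

/-- Half the trace of `x`; on the conjugacy class of `diag(e^{iθ}, e^{-iθ})` it is `cos θ`. -/
noncomputable def halfTrace (x : SU2) : ℝ := x.1.trace.re / 2

theorem continuous_halfTrace : Continuous halfTrace :=
  (Complex.continuous_re.comp (Continuous.matrix_trace continuous_subtype_val)).div_const 2

theorem halfTrace_conj (h x : SU2) : halfTrace (h * x * h⁻¹) = halfTrace x := by
  have : (h * x * h⁻¹ : SU2).1.trace = x.1.trace := by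
    change (h.1 * x.1 * (h⁻¹ : SU2).1).trace = _
    rw [Matrix.trace_mul_comm, ← mul_assoc]
    change ((h⁻¹ * h : SU2).1 * x.1).trace = _
    simp
  rw [halfTrace, this, halfTrace]

theorem halfTrace_torus (θ : ℝ) : halfTrace (torus θ) = Real.cos θ := by
  have : (Complex.exp (-(θ * Complex.I))).re = Real.cos θ := by
    rw [← neg_mul, ← Complex.ofReal_neg, Complex.exp_ofReal_mul_I_re, Real.cos_neg]
  simp [halfTrace, torus, Matrix.trace_fin_two, Complex.exp_ofReal_mul_I_re, this]

theorem character_conj (n : ℕ) (h x : SU2) :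
    (irrep n).character (h * x * h⁻¹) = (irrep n).character x :=
  Representation.char_conj _ _ _

theorem star_eq_adjugate (x : SU2) : star x.1 = x.1.adjugate := by
  have h₁ : star x.1 * x.1 = 1 := (Matrix.mem_unitaryGroup_iff').1 x.2.1
  have h₂ : x.1 * x.1.adjugate = 1 := by
    rw [Matrix.mul_adjugate, (Matrix.mem_specialUnitaryGroup_iff.1 x.2).2, one_smul]
  rw [← mul_one (star x.1), ← h₂, ← mul_assoc, h₁, one_mul]

theorem apply_one_one (x : SU2) : x.1 1 1 = star (x.1 0 0) := by
  have := congr_fun₂ (star_eq_adjugate x) 0 0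
  simpa [Matrix.adjugate_fin_two, Matrix.star_apply] using this.symm

theorem apply_zero_one (x : SU2) : x.1 0 1 = -star (x.1 1 0) := by
  have := congr_fun₂ (star_eq_adjugate x) 0 1
  simp only [Matrix.adjugate_fin_two, Matrix.star_apply] at this
  rw [this]
  simp

theorem apply_mul_star_add (x : SU2) :
    x.1 0 0 * star (x.1 0 0) + x.1 1 0 * star (x.1 1 0) = 1 := by
  have := (Matrix.mem_specialUnitaryGroup_iff.1 x.2).2
  rw [Matrix.det_fin_two, apply_one_one, apply_zero_one] at this
  linear_combination this

theorem matrix_mem_of_sq_add_sq {a c : ℂ} (h : a * star a + c * star c = 1) :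
    !![a, -star c; c, star a] ∈ Matrix.specialUnitaryGroup (Fin 2) ℂ := by
  simp only [RCLike.star_def] at h ⊢
  rw [Matrix.mem_specialUnitaryGroup_iff, Matrix.mem_unitaryGroup_iff]
  constructor
  · ext i j
    fin_cases i <;> fin_cases j <;>
      simp [Matrix.mul_apply, Fin.sum_univ_two, Matrix.star_apply]
    · linear_combination h
    · ring
    · ring
    · linear_combination h
  · simp only [Matrix.det_fin_two_of]
    linear_combination h

/-- Every element is diagonalised by the special unitary matrix whose first column is a unit
eigenvector. -/
theorem exists_conj_torus_real (x : SU2) : ∃ (h : SU2) (θ : ℝ), x = h * torus θ * h⁻¹ := by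
  obtain ⟨l, hl⟩ := Module.End.exists_eigenvalue (Matrix.toLin' x.1)
  obtain ⟨v, hv, hv0⟩ := hl.exists_hasEigenvector
  rw [Module.End.mem_eigenspace_iff, Matrix.toLin'_apply] at hv
  set r : ℝ := Real.sqrt (Complex.normSq (v 0) + Complex.normSq (v 1)) with hr
  have hpos : 0 < Complex.normSq (v 0) + Complex.normSq (v 1) := by
    rcases (add_nonneg (Complex.normSq_nonneg (v 0)) (Complex.normSq_nonneg (v 1))).lt_or_eq
      with h | h
    · exact h
    · refine absurd ?_ hv0
      have h0 := Complex.normSq_nonneg (v 0)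
      have h1 := Complex.normSq_nonneg (v 1)
      have z0 : v 0 = 0 := Complex.normSq_eq_zero.1 (by linarith)
      have z1 : v 1 = 0 := Complex.normSq_eq_zero.1 (by linarith)
      ext k
      fin_cases k
      · exact z0
      · exact z1
  have hr0 : (r : ℂ) ≠ 0 := by simpa using (Real.sqrt_pos.2 hpos).ne'
  have hr2 : (r : ℂ) ^ 2 = v 0 * star (v 0) + v 1 * star (v 1) := by
    rw [← Complex.ofReal_pow, Real.sq_sqrt hpos.le]
    simp [Complex.mul_conj]
  have e0 : x.1 0 0 * v 0 - star (x.1 1 0) * v 1 = l * v 0 := by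
    have := congr_fun hv 0
    simp only [Matrix.mulVec, dotProduct, Fin.sum_univ_two, Pi.smul_apply, smul_eq_mul,
      apply_zero_one] at this
    linear_combination this
  have e1 : x.1 1 0 * v 0 + star (x.1 0 0) * v 1 = l * v 1 := by
    have := congr_fun hv 1
    simp only [Matrix.mulVec, dotProduct, Fin.sum_univ_two, Pi.smul_apply, smul_eq_mul,
      apply_one_one] at this
    linear_combination this
  have s0 := congr_arg star e0
  have s1 := congr_arg star e1
  have hx := apply_mul_star_add x
  simp only [star_sub, star_add, star_mul', star_star] at s0 s1
  have hl1 : l * star l = 1 := by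
    have : (l * star l - 1) * (r : ℂ) ^ 2 = 0 := by
      rw [hr2]
      linear_combination (-star l * star (v 0)) * e0 - (star l * star (v 1)) * e1 -
        (x.1 0 0 * v 0 - star (x.1 1 0) * v 1) * s0 -
        (x.1 1 0 * v 0 + star (x.1 0 0) * v 1) * s1 +
        (v 0 * star (v 0) + v 1 * star (v 1)) * hx
    simpa [hr0, sub_eq_zero] using this
  have hl : Complex.exp (l.arg * Complex.I) = l := by
    have hn : ‖l‖ = 1 := by
      have : ((‖l‖ ^ 2 : ℝ) : ℂ) = 1 := by
        rw [← hl1, ← Complex.normSq_eq_norm_sq, Complex.star_def, Complex.mul_conj]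
      have : ‖l‖ ^ 2 = 1 := by exact_mod_cast this
      nlinarith [norm_nonneg l]
    simpa [hn] using Complex.norm_mul_exp_arg_mul_I l
  have hl' : Complex.exp (-(l.arg * Complex.I)) = star l := by
    rw [Complex.exp_neg, hl]
    exact inv_eq_of_mul_eq_one_right hl1
  have hsr : star (r : ℂ) = r := Complex.conj_ofReal r
  refine ⟨⟨!![v 0 / r, -star (v 1 / r); v 1 / r, star (v 0 / r)], matrix_mem_of_sq_add_sq ?_⟩,
    l.arg, ?_⟩
  · simp only [star_div₀, hsr]
    field_simp
    rw [hr2]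
  · rw [eq_mul_inv_iff_mul_eq]
    apply Subtype.ext
    change x.1 * !![v 0 / r, -star (v 1 / r); v 1 / r, star (v 0 / r)] =
      !![v 0 / r, -star (v 1 / r); v 1 / r, star (v 0 / r)] *
        !![Complex.exp (l.arg * Complex.I), 0; 0, Complex.exp (-(l.arg * Complex.I))]
    rw [hl, hl', Matrix.eta_fin_two x.1, apply_one_one, apply_zero_one, Matrix.mul_fin_two,
      Matrix.mul_fin_two]
    simp only [star_div₀, hsr]
    ext i j
    fin_cases i <;> fin_cases j <;>
      simp [-RCLike.star_def, -Complex.star_def] <;> field_simp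
    · linear_combination e0
    · linear_combination -s1
    · linear_combination e1
    · linear_combination s0

/-- Conjugation by the Weyl element inverts the torus, so the angle may be taken in `[0, π]`. -/
theorem exists_conj_torus (x : SU2) :
    ∃ (h : SU2), ∃ θ ∈ Set.Icc 0 Real.pi, x = h * torus θ * h⁻¹ := by
  obtain ⟨h, θ, hθ, rfl⟩ : ∃ (h : SU2) (θ : ℝ), θ ∈ Set.Ioc (-Real.pi) Real.pi ∧
      x = h * torus θ * h⁻¹ := by
    obtain ⟨h, θ, rfl⟩ := exists_conj_torus_real x
    refine ⟨h, (Complex.exp (θ * Complex.I)).arg, Complex.arg_mem_Ioc _, ?_⟩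
    congr 2
    apply Subtype.ext
    have : Complex.exp ((Complex.exp (θ * Complex.I)).arg * Complex.I) =
        Complex.exp (θ * Complex.I) := by
      simpa using Complex.norm_mul_exp_arg_mul_I (Complex.exp (θ * Complex.I))
    simp [torus, Complex.exp_neg, this]
  rcases le_or_gt 0 θ with h0 | h0
  · exact ⟨h, θ, ⟨h0, hθ.2⟩, rfl⟩
  · let w : SU2 := ⟨!![0, -star 1; 1, star 0], matrix_mem_of_sq_add_sq (by simp)⟩
    have hw : torus θ = w * torus (-θ) * w⁻¹ := by
      rw [eq_mul_inv_iff_mul_eq]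
      apply Subtype.ext
      change (torus θ).1 * w.1 = w.1 * (torus (-θ)).1
      simp [torus, w]
    refine ⟨h * w, -θ, ⟨by linarith, by linarith [hθ.1]⟩, ?_⟩
    rw [hw]
    group

theorem character_eq_chebyshevU (n : ℕ) (x : SU2) :
    (irrep n).character x = (((Polynomial.Chebyshev.U ℝ n).eval (halfTrace x) : ℝ) : ℂ) := by
  obtain ⟨h, θ, -, rfl⟩ := exists_conj_torus x
  rw [character_conj, halfTrace_conj, halfTrace_torus, character_eq_trace, repMatrix_torus,
    Matrix.trace_diagonal, Polynomial.Chebyshev.complex_ofReal_eval_U, Complex.ofReal_cos]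
  rw [Fin.sum_univ_eq_sum_range (fun i => Complex.exp (θ * Complex.I) ^ i *
    Complex.exp (-(θ * Complex.I)) ^ (n - i)) (n + 1), sum_pow_mul_pow_eq_chebyshevU
    (by simp [← Complex.exp_add]), Complex.cos, neg_mul]

end SU2

/-! ### Haar averages and Schur's lemma -/

namespace SU2

instance : haar.IsHaarMeasure := by
  unfold haar
  infer_instance

instance : IsProbabilityMeasure haar :=
  ⟨by simpa [haar] using
    Measure.haarMeasure_self (K₀ := (⊤ : TopologicalSpace.PositiveCompacts SU2))⟩

/-- The compact group `SU(2)` is unimodular: a right translate of Haar measure is again a Haar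
probability measure. -/
instance : haar.IsMulRightInvariant := by
  refine ⟨fun g => ?_⟩
  have : IsProbabilityMeasure (Measure.map (· * g) haar) :=
    Measure.isProbabilityMeasure_map (measurable_mul_const g).aemeasurable
  exact Measure.isHaarMeasure_eq_of_isProbabilityMeasure _ _

theorem integrable_of_continuous {E : Type*} [NormedAddCommGroup E] {f : SU2 → E}
    (hf : Continuous f) : Integrable f haar :=
  hf.integrable_of_hasCompactSupport (HasCompactSupport.of_compactSpace f)

/-- The entrywise Haar integral of a matrix-valued function. -/
noncomputable def integralMatrix {ι : Type*} (M : SU2 → Matrix ι ι ℂ) : Matrix ι ι ℂ :=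
  Matrix.of fun i j => ∫ h, M h i j ∂haar

theorem mul_integralMatrix_mul {ι : Type*} [Fintype ι] {M : SU2 → Matrix ι ι ℂ}
    (hM : Continuous M) (B C : Matrix ι ι ℂ) :
    B * integralMatrix M * C = integralMatrix fun h => B * M h * C := by
  have hM' (i j : ι) : Integrable (fun h => M h i j) haar :=
    integrable_of_continuous (hM.matrix_elem i j)
  ext i j
  simp only [integralMatrix, Matrix.mul_apply, Matrix.of_apply, Finset.sum_mul]
  rw [integral_finsetSum _ fun k _ => integrable_finsetSum _ fun l _ =>
    ((hM' l k).const_mul _).mul_const _]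
  refine Finset.sum_congr rfl fun k _ => ?_
  rw [integral_finsetSum _ fun l _ => ((hM' l k).const_mul _).mul_const _]
  refine Finset.sum_congr rfl fun l _ => ?_
  rw [integral_mul_const, integral_const_mul]

theorem trace_integralMatrix {ι : Type*} [Fintype ι] {M : SU2 → Matrix ι ι ℂ}
    (hM : Continuous M) : (integralMatrix M).trace = ∫ h, (M h).trace ∂haar := by
  simp only [integralMatrix, Matrix.trace, Matrix.diag, Matrix.of_apply]
  rw [integral_finsetSum _ fun k _ => integrable_of_continuous (hM.matrix_elem k k)]

/-- A matrix commuting with `π_n(diag(e^{iθ}, e^{-iθ}))` is diagonal as soon as the weights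
`e^{iθ(2j - n)}` are distinct. -/
theorem eq_zero_of_commute_repMatrix_torus (n : ℕ) {E : Matrix (Fin (n + 1)) (Fin (n + 1)) ℂ}
    (h : ∀ x, repMatrix n x * E = E * repMatrix n x) {i j : Fin (n + 1)} (hij : i ≠ j) :
    E i j = 0 := by
  -- With `θ = 1 / (n + 1)` all the arguments `θ (2 j - n)` lie in `(-π, π)`.
  set θ : ℝ := 1 / (n + 1) with hθ
  have hn : (0 : ℝ) < n + 1 := by positivity
  have hw (k : Fin (n + 1)) : Complex.exp (θ * Complex.I) ^ (k : ℕ) *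
      Complex.exp (-(θ * Complex.I)) ^ (n - k : ℕ) =
      Complex.exp (((θ * (2 * (k : ℕ) - n) : ℝ) : ℂ) * Complex.I) := by
    rw [← Complex.exp_nat_mul, ← Complex.exp_nat_mul, ← Complex.exp_add,
      Nat.cast_sub (Nat.le_of_lt_succ k.2)]
    congr 1
    push_cast
    ring
  have hb (k : Fin (n + 1)) : |θ * (2 * (k : ℕ) - n)| < Real.pi := by
    have hk : ((k : ℕ) : ℝ) ≤ n := by exact_mod_cast Nat.le_of_lt_succ k.2
    have hk0 : (0 : ℝ) ≤ (k : ℕ) := by positivity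
    have : |2 * ((k : ℕ) : ℝ) - n| ≤ n + 1 := abs_le.2 ⟨by linarith, by linarith⟩
    rw [abs_mul, abs_of_pos (by positivity), hθ]
    calc 1 / ((n : ℝ) + 1) * |2 * ((k : ℕ) : ℝ) - n| ≤ 1 / ((n : ℝ) + 1) * (n + 1) := by gcongr
      _ = 1 := by field_simp
      _ < Real.pi := by linarith [Real.pi_gt_three]
  have hne : Complex.exp (((θ * (2 * (i : ℕ) - n) : ℝ) : ℂ) * Complex.I) ≠
      Complex.exp (((θ * (2 * (j : ℕ) - n) : ℝ) : ℂ) * Complex.I) := by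
    intro he
    have := Complex.exp_inj_of_neg_pi_lt_of_le_pi
      (by simpa using (abs_lt.1 (hb i)).1) (by simpa using (abs_lt.1 (hb i)).2.le)
      (by simpa using (abs_lt.1 (hb j)).1) (by simpa using (abs_lt.1 (hb j)).2.le) he
    have h2 : θ * (2 * (i : ℕ) - n) = θ * (2 * (j : ℕ) - n) := by
      exact_mod_cast mul_right_cancel₀ Complex.I_ne_zero this
    have h3 := mul_left_cancel₀ (by positivity : θ ≠ 0) h2
    have : ((i : ℕ) : ℝ) = (j : ℕ) := by linarith
    exact hij (Fin.ext (by exact_mod_cast this))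
  have := congr_fun₂ (h (torus θ)) i j
  rw [repMatrix_torus, Matrix.diagonal_mul, Matrix.mul_diagonal, hw, hw, mul_comm (E i j)] at this
  have h0 : (Complex.exp (((θ * (2 * (i : ℕ) - n) : ℝ) : ℂ) * Complex.I) -
      Complex.exp (((θ * (2 * (j : ℕ) - n) : ℝ) : ℂ) * Complex.I)) * E i j = 0 := by
    rw [sub_mul, this, sub_self]
  exact (mul_eq_zero.1 h0).resolve_left (sub_ne_zero.2 hne)

theorem repMatrix_last (n : ℕ) (x : SU2) (i : Fin (n + 1)) :
    repMatrix n x i (Fin.last n) =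
      x.1 0 0 ^ (i : ℕ) * x.1 1 0 ^ (n - i : ℕ) * (n.choose i : ℂ) := by
  have hterm (m : ℕ) : (MvPolynomial.C (x.1 0 0) * MvPolynomial.X 0) ^ m *
      (MvPolynomial.C (x.1 1 0) * MvPolynomial.X 1) ^ (n - m) * (n.choose m : MvPolynomial _ ℂ) =
      MvPolynomial.monomial (Finsupp.single (0 : Fin 2) m + Finsupp.single 1 (n - m))
        (x.1 0 0 ^ m * x.1 1 0 ^ (n - m) * (n.choose m : ℂ)) := by
    rw [MvPolynomial.monomial_add_single, ← MvPolynomial.C_mul_X_pow_eq_monomial]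
    simp only [mul_pow, map_mul, map_pow, map_natCast]
    ring
  rw [repMatrix_apply, Fin.val_last, Nat.sub_self, pow_zero, mul_one, add_pow]
  simp only [hterm, MvPolynomial.coeff_sum, MvPolynomial.coeff_monomial]
  rw [Finset.sum_eq_single (i : ℕ)]
  · simp [homExponent]
  · intro m _ hm
    refine if_neg fun h => hm ?_
    simpa [homExponent] using DFunLike.congr_fun h 0
  · intro h
    exact absurd (Finset.mem_range.2 i.2) h

/-- Schur's lemma for `π_n`: commuting with the torus forces a matrix to be diagonal, and commuting
with one rotation whose matrix has a column without zeros forces its entries to agree. -/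
theorem exists_eq_smul_one_of_commute_repMatrix (n : ℕ)
    {E : Matrix (Fin (n + 1)) (Fin (n + 1)) ℂ}
    (h : ∀ x, repMatrix n x * E = E * repMatrix n x) : ∃ c : ℂ, E = c • 1 := by
  have hE : E = Matrix.diagonal fun i => E i i := by
    ext i j
    rw [Matrix.diagonal_apply]
    split_ifs with hij
    · rw [hij]
    · exact eq_zero_of_commute_repMatrix_torus n h hij
  let r : SU2 := ⟨!![3 / 5, -star (4 / 5); 4 / 5, star (3 / 5)], matrix_mem_of_sq_add_sq (by
    simp only [star_div₀, star_ofNat]; norm_num)⟩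
  refine ⟨E (Fin.last n) (Fin.last n), ?_⟩
  ext i j
  by_cases hij : i = j
  · subst hij
    have := congr_fun₂ (h r) i (Fin.last n)
    rw [hE, Matrix.diagonal_mul, Matrix.mul_diagonal, mul_comm] at this
    have hr : repMatrix n r i (Fin.last n) ≠ 0 := by
      rw [repMatrix_last]
      have : (n.choose i : ℂ) ≠ 0 := by
        exact_mod_cast (Nat.choose_pos (Nat.le_of_lt_succ i.2)).ne'
      simp [r, this]
    simpa using (mul_right_cancel₀ hr this).symm
  · simp [Matrix.one_apply_ne hij, eq_zero_of_commute_repMatrix_torus n h hij]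

theorem repMatrix_inv_mul (n : ℕ) (x : SU2) : repMatrix n x⁻¹ * repMatrix n x = 1 := by
  rw [← repMatrix_mul, inv_mul_cancel, repMatrix_one]

/-- Averaging `π_n(y)` over its conjugates gives the scalar matrix with the same trace. -/
theorem integralMatrix_conj (n : ℕ) (y : SU2) :
    integralMatrix (fun h => repMatrix n (h * y * h⁻¹)) =
      ((irrep n).character y / (n + 1)) • 1 := by
  have hcont : Continuous fun h : SU2 => repMatrix n (h * y * h⁻¹) :=
    (continuous_repMatrix n).comp (by fun_prop)
  obtain ⟨c, hc⟩ := exists_eq_smul_one_of_commute_repMatrix n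
    (E := integralMatrix (fun h => repMatrix n (h * y * h⁻¹))) fun k => by
    have : repMatrix n k * integralMatrix (fun h => repMatrix n (h * y * h⁻¹)) *
        repMatrix n k⁻¹ = integralMatrix (fun h => repMatrix n (h * y * h⁻¹)) := by
      rw [mul_integralMatrix_mul hcont]
      simp only [← repMatrix_mul]
      ext i j
      simp only [integralMatrix, Matrix.of_apply]
      rw [← integral_mul_left_eq_self (fun h => repMatrix n (h * y * h⁻¹) i j) k]
      simp only [mul_inv_rev, mul_assoc]
    conv_rhs => rw [← this]
    rw [mul_assoc _ _ (repMatrix n k), repMatrix_inv_mul, mul_one]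
  have ht := trace_integralMatrix hcont
  simp only [← character_eq_trace, character_conj] at ht
  rw [hc] at ht ⊢
  have hn : (n : ℂ) + 1 ≠ 0 := by exact_mod_cast n.succ_ne_zero
  simp only [Matrix.trace_smul, Matrix.trace_one, Fintype.card_fin, smul_eq_mul,
    integral_const, probReal_univ, one_smul] at ht
  rw [← ht]
  congr 1
  push_cast
  field_simp

theorem continuous_character (n : ℕ) : Continuous (irrep n).character := by
  simp only [funext (character_eq_trace n)]
  exact (continuous_repMatrix n).matrix_trace

/-- The functional equation of the characters. -/
theorem integral_character_mul_conj (n : ℕ) (x y : SU2) :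
    ∫ h, (irrep n).character (x * (h * y * h⁻¹)) ∂haar =
      (irrep n).character x * (irrep n).character y / (n + 1) := by
  have hcont : Continuous fun h : SU2 => repMatrix n (h * y * h⁻¹) :=
    (continuous_repMatrix n).comp (by fun_prop)
  have h1 := mul_integralMatrix_mul hcont (repMatrix n x) 1
  simp only [mul_one, ← repMatrix_mul] at h1
  have h2 := trace_integralMatrix (M := fun h => repMatrix n (x * (h * y * h⁻¹)))
    ((continuous_repMatrix n).comp (by fun_prop))
  simp only [← h1, integralMatrix_conj, ← character_eq_trace] at h2
  rw [← h2, Matrix.mul_smul, mul_one, Matrix.trace_smul, ← character_eq_trace, smul_eq_mul]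
  ring

/-- The nontrivial characters have mean zero: the mean of `π_n` is a scalar invariant under
`π_n`, and `χ_n` vanishes at `θ = π / (n + 1)`. -/
theorem integral_character_eq_zero {n : ℕ} (hn : n ≠ 0) :
    ∫ y, (irrep n).character y ∂haar = 0 := by
  have hcont := continuous_repMatrix n
  have hl (k : SU2) : repMatrix n k * integralMatrix (repMatrix n) =
      integralMatrix (repMatrix n) := by
    have := mul_integralMatrix_mul hcont (repMatrix n k) 1
    simp only [mul_one, ← repMatrix_mul] at this
    rw [this]
    ext i j
    exact integral_mul_left_eq_self (fun h => repMatrix n h i j) k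
  have hr (k : SU2) : integralMatrix (repMatrix n) * repMatrix n k =
      integralMatrix (repMatrix n) := by
    have := mul_integralMatrix_mul hcont 1 (repMatrix n k)
    simp only [one_mul, ← repMatrix_mul] at this
    rw [this]
    ext i j
    exact integral_mul_right_eq_self (fun h => repMatrix n h i j) k
  obtain ⟨c, hc⟩ := exists_eq_smul_one_of_commute_repMatrix n
    (E := integralMatrix (repMatrix n)) fun k => by rw [hl, hr]
  have ht := trace_integralMatrix hcont
  simp only [← character_eq_trace] at ht
  have hk := congr_arg Matrix.trace (hl (torus (Real.pi / (n + 1))))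
  have hs : (irrep n).character (torus (Real.pi / (n + 1))) = 0 := by
    rw [character_eq_chebyshevU, halfTrace_torus]
    have hpos : 0 < Real.sin (Real.pi / (n + 1)) := by
      refine Real.sin_pos_of_pos_of_lt_pi (by positivity) (div_lt_self Real.pi_pos ?_)
      have : (0 : ℝ) < n := by exact_mod_cast Nat.pos_of_ne_zero hn
      linarith
    have := Polynomial.Chebyshev.U_real_cos (Real.pi / (n + 1)) n
    rw [Int.cast_natCast, mul_div_cancel₀ _ (by positivity), Real.sin_pi] at this
    rw [(mul_eq_zero.1 this).resolve_right hpos.ne', Complex.ofReal_zero]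
  rw [← ht, ← hk, hc, Matrix.mul_smul, mul_one, Matrix.trace_smul, ← character_eq_trace, hs,
    smul_zero]

end SU2

/-! ### Class functions and Weyl's integration formula -/

open Polynomial.Chebyshev in
theorem span_range_chebyshevU :
    Submodule.span ℝ (Set.range fun n : ℕ => U ℝ n) = ⊤ := by
  set S := Submodule.span ℝ (Set.range fun n : ℕ => U ℝ n)
  have hU (n : ℕ) : U ℝ n ∈ S := Submodule.subset_span ⟨n, rfl⟩
  have hX : ∀ p ∈ S, Polynomial.X * p ∈ S := by
    intro p hp
    induction hp using Submodule.span_induction with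
    | mem p hp =>
      obtain ⟨n, rfl⟩ := hp
      have h1 : U ℝ ((n : ℤ) - 1) ∈ S := by
        cases n with
        | zero => simp
        | succ n => simpa using hU n
      have h2 : Polynomial.X * U ℝ n =
          (1 / 2 : ℝ) • (U ℝ (n + 1 : ℕ) + U ℝ ((n : ℤ) - 1)) := by
        have : U ℝ (n + 1 : ℕ) + U ℝ ((n : ℤ) - 1) = (2 : ℝ) • (Polynomial.X * U ℝ n) := by
          push_cast
          rw [U_add_one, two_smul]
          ring
        rw [this, smul_smul]
        norm_num
      rw [h2]
      exact S.smul_mem _ (S.add_mem (hU _) h1)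
    | zero => simp
    | add p q _ _ hp hq => rw [mul_add]; exact S.add_mem hp hq
    | smul c p _ hp => rw [mul_smul_comm]; exact S.smul_mem c hp
  have h1 (n : ℕ) : (Polynomial.X : Polynomial ℝ) ^ n ∈ S := by
    induction n with
    | zero => simpa using hU 0
    | succ n ih => rw [pow_succ']; exact hX _ ih
  rw [eq_top_iff]
  intro p _
  rw [p.as_sum_range_C_mul_X_pow]
  refine S.sum_mem fun n _ => ?_
  rw [← Polynomial.smul_eq_C_mul]
  exact S.smul_mem _ (h1 n)

open Real Polynomial.Chebyshev in
theorem integral_chebyshevU_cos_mul_sin_sq (n : ℕ) :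
    ∫ t in (0)..π, (U ℝ n).eval (cos t) * sin t ^ 2 = if n = 0 then π / 2 else 0 := by
  have h (t : ℝ) : (U ℝ n).eval (cos t) * sin t ^ 2 =
      (cos (n * t) - cos ((n + 2) * t)) / 2 := by
    have h1 : (U ℝ n).eval (cos t) * sin t ^ 2 = sin ((n + 1) * t) * sin t := by
      have := U_real_cos t n
      rw [Int.cast_natCast] at this
      rw [← this]
      ring
    have h2 : cos (n * t) = cos ((n + 1) * t - t) := by congr 1; ring
    have h3 : cos ((n + 2) * t) = cos ((n + 1) * t + t) := by congr 1; ring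
    rw [h1, h2, h3, cos_add, cos_sub]
    ring
  have hint (c : ℝ) (hc : c ≠ 0) : ∫ t in (0)..π, cos (c * t) = sin (c * π) / c := by
    rw [intervalIntegral.integral_comp_mul_left _ hc]
    simp [div_eq_inv_mul]
  have hn2 : ((n : ℝ) + 2) ≠ 0 := by positivity
  simp only [h]
  rw [intervalIntegral.integral_div, intervalIntegral.integral_sub
    ((by fun_prop : Continuous _).intervalIntegrable _ _)
    ((by fun_prop : Continuous _).intervalIntegrable _ _), hint _ hn2]
  have hs : sin (((n : ℝ) + 2) * π) = 0 := by exact_mod_cast sin_nat_mul_pi (n + 2)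
  rw [hs]
  split_ifs with h0
  · simp [h0]
  · rw [hint _ (by exact_mod_cast h0), sin_nat_mul_pi]
    simp

namespace SU2

theorem halfTrace_mem_Icc (x : SU2) : halfTrace x ∈ Set.Icc (-1 : ℝ) 1 := by
  obtain ⟨h, θ, -, rfl⟩ := exists_conj_torus x
  rw [halfTrace_conj, halfTrace_torus]
  exact Real.cos_mem_Icc θ

theorem integral_polynomial_halfTrace (p : Polynomial ℝ) :
    ∫ x, p.eval (halfTrace x) ∂haar =
      2 / Real.pi * ∫ t in (0)..Real.pi, p.eval (Real.cos t) * Real.sin t ^ 2 := by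
  have hp : p ∈ Submodule.span ℝ (Set.range fun n : ℕ => Polynomial.Chebyshev.U ℝ n) := by
    rw [span_range_chebyshevU]
    trivial
  have hi (p : Polynomial ℝ) : Integrable (fun x => p.eval (halfTrace x)) haar :=
    integrable_of_continuous (p.continuous.comp continuous_halfTrace)
  have hj (p : Polynomial ℝ) : IntervalIntegrable
      (fun t => p.eval (Real.cos t) * Real.sin t ^ 2) volume 0 Real.pi :=
    (by fun_prop : Continuous _).intervalIntegrable _ _
  induction hp using Submodule.span_induction with
  | mem p hp =>
    obtain ⟨n, rfl⟩ := hp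
    simp only
    rw [integral_chebyshevU_cos_mul_sin_sq]
    split_ifs with h0
    · have := Real.pi_pos.ne'
      subst h0
      simp
    · have := integral_character_eq_zero h0
      simp only [character_eq_chebyshevU] at this
      rw [integral_complex_ofReal] at this
      rw [mul_zero]
      exact_mod_cast this
  | zero => simp
  | add p q _ _ hp hq =>
    simp only [Polynomial.eval_add, add_mul]
    rw [integral_add (hi p) (hi q), intervalIntegral.integral_add (hj p) (hj q), hp, hq, mul_add]
  | smul c p _ hp =>
    simp only [Polynomial.eval_smul, smul_eq_mul, mul_assoc]
    rw [integral_const_mul, intervalIntegral.integral_const_mul, hp]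
    ring

/-- Weyl's integration formula for `SU(2)`, deduced from the case of polynomials by Weierstrass
approximation. -/
theorem integral_comp_halfTrace {φ : ℝ → ℝ} (hφ : ContinuousOn φ (Set.Icc (-1) 1)) :
    ∫ x, φ (halfTrace x) ∂haar =
      2 / Real.pi * ∫ t in (0)..Real.pi, φ (Real.cos t) * Real.sin t ^ 2 := by
  have hi : Integrable (fun x => φ (halfTrace x)) haar :=
    integrable_of_continuous (hφ.comp_continuous continuous_halfTrace halfTrace_mem_Icc)
  have hcos : Continuous fun t => φ (Real.cos t) :=
    hφ.comp_continuous Real.continuous_cos Real.cos_mem_Icc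
  have hj : IntervalIntegrable (fun t => φ (Real.cos t) * Real.sin t ^ 2) volume 0 Real.pi :=
    (hcos.mul (by fun_prop)).intervalIntegrable _ _
  refine eq_of_forall_dist_le fun ε hε => ?_
  obtain ⟨p, hp⟩ := exists_polynomial_near_of_continuousOn (-1) 1 φ hφ (ε / 3) (by positivity)
  have h1 : |∫ x, φ (halfTrace x) ∂haar - ∫ x, p.eval (halfTrace x) ∂haar| ≤ ε / 3 := by
    have hpi : Integrable (fun x => p.eval (halfTrace x)) haar :=
      integrable_of_continuous (p.continuous.comp continuous_halfTrace)
    rw [← integral_sub hi hpi]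
    have := norm_integral_le_of_norm_le_const (μ := haar) (C := ε / 3)
      (f := fun x => φ (halfTrace x) - p.eval (halfTrace x)) (Eventually.of_forall fun x => by
        rw [Real.norm_eq_abs, abs_sub_comm]
        exact (hp _ (halfTrace_mem_Icc x)).le)
    simpa using this
  have h2 : |(∫ t in (0)..Real.pi, p.eval (Real.cos t) * Real.sin t ^ 2) -
      ∫ t in (0)..Real.pi, φ (Real.cos t) * Real.sin t ^ 2| ≤ ε / 3 * Real.pi := by
    rw [← intervalIntegral.integral_sub ((by fun_prop : Continuous _).intervalIntegrable _ _) hj]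
    have := intervalIntegral.norm_integral_le_of_norm_le_const (a := 0) (b := Real.pi)
      (C := ε / 3) (f := fun t => p.eval (Real.cos t) * Real.sin t ^ 2 -
        φ (Real.cos t) * Real.sin t ^ 2) (fun t _ => by
        rw [← sub_mul, norm_mul, Real.norm_eq_abs, Real.norm_eq_abs,
          abs_of_nonneg (sq_nonneg (Real.sin t))]
        exact (mul_le_of_le_one_right (abs_nonneg _) (Real.sin_sq_le_one t)).trans
          (hp _ (Real.cos_mem_Icc t)).le)
    simpa [abs_of_pos Real.pi_pos] using this
  rw [integral_polynomial_halfTrace] at h1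
  rw [Real.dist_eq]
  have h3 : |2 / Real.pi * (∫ t in (0)..Real.pi, p.eval (Real.cos t) * Real.sin t ^ 2) -
      2 / Real.pi * ∫ t in (0)..Real.pi, φ (Real.cos t) * Real.sin t ^ 2| ≤ 2 / 3 * ε := by
    rw [← mul_sub, abs_mul, abs_of_pos (by positivity)]
    calc _ ≤ 2 / Real.pi * (ε / 3 * Real.pi) := by gcongr
      _ = 2 / 3 * ε := by
        have := Real.pi_pos.ne'
        field_simp
  calc _ ≤ _ := abs_sub_le _ _ _
    _ ≤ ε / 3 + 2 / 3 * ε := add_le_add h1 h3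
    _ = ε := by ring

theorem halfTrace_inv (x : SU2) : halfTrace x⁻¹ = halfTrace x := by
  change (star x.1).trace.re / 2 = x.1.trace.re / 2
  rw [Matrix.star_eq_conjTranspose, Matrix.trace_conjTranspose]
  simp

theorem eq_torus_arccos_halfTrace {f : SU2 → ℝ} (hc : ∀ x y, f (y * x * y⁻¹) = f x) (x : SU2) :
    f x = f (torus (Real.arccos (halfTrace x))) := by
  obtain ⟨h, θ, hθ, rfl⟩ := exists_conj_torus x
  rw [halfTrace_conj, halfTrace_torus, Real.arccos_cos hθ.1 hθ.2, hc]

theorem continuous_torus : Continuous torus := by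
  refine Continuous.subtype_mk (continuous_matrix fun i j => ?_) _
  fin_cases i <;> fin_cases j <;> simp <;> fun_prop

/-- Convolving a central function with `χ_n` multiplies `χ_n` by a Fourier coefficient. -/
theorem integral_character_mul_central (n : ℕ) {f : SU2 → ℝ} (hf : Continuous f)
    (hc : ∀ x y, f (y * x * y⁻¹) = f x) (x : SU2) :
    ∫ y, (irrep n).character y * (f (y⁻¹ * x) : ℂ) ∂haar =
      (irrep n).character x / (n + 1) * ∫ y, (irrep n).character y * (f y : ℂ) ∂haar := by
  have hχ := continuous_character n
  have hinv (y : SU2) : f y⁻¹ = f y := by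
    rw [eq_torus_arccos_halfTrace hc, halfTrace_inv, ← eq_torus_arccos_halfTrace hc]
  have h1 : ∫ y, (irrep n).character y * (f (y⁻¹ * x) : ℂ) ∂haar =
      ∫ y, (irrep n).character (x * y) * (f y : ℂ) ∂haar := by
    rw [← integral_mul_left_eq_self _ x]
    simp [hinv]
  have h2 (h : SU2) : ∫ y, (irrep n).character (x * (h * y * h⁻¹)) * (f y : ℂ) ∂haar =
      ∫ y, (irrep n).character (x * y) * (f y : ℂ) ∂haar := by
    have e1 := integral_mul_left_eq_self (μ := haar)
      (fun y => (irrep n).character (x * (y * h⁻¹)) * (f (y * h⁻¹) : ℂ)) h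
    have e2 := integral_mul_right_eq_self (μ := haar)
      (fun y => (irrep n).character (x * y) * (f y : ℂ)) h⁻¹
    rw [← e2, ← e1]
    simp only [hc]
  have h3 : ∫ h, ∫ y, (irrep n).character (x * (h * y * h⁻¹)) * (f y : ℂ) ∂haar ∂haar =
      ∫ y, (irrep n).character (x * y) * (f y : ℂ) ∂haar := by
    simp [h2]
  rw [h1, ← h3, integral_integral_swap_of_hasCompactSupport
    (by fun_prop) (HasCompactSupport.of_compactSpace _), ← integral_const_mul]
  congr 1
  ext y
  rw [integral_mul_const, integral_character_mul_conj]
  ring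

/-- The `N`-th partial sum, at an angle `θ`, of the expansion in the functions `U_n(cos θ)`,
orthogonal with respect to the weight `sin² t`. -/
noncomputable def chebyshevPartialSum (N : ℕ) (F : ℝ → ℝ) (θ : ℝ) : ℝ :=
  2 / Real.pi * ∫ t in (0)..Real.pi, F t * (∑ n ∈ Finset.range (N + 1),
    (Polynomial.Chebyshev.U ℝ n).eval (Real.cos θ) *
      (Polynomial.Chebyshev.U ℝ n).eval (Real.cos t)) * Real.sin t ^ 2

/-- On class functions the Fourier partial sums are Chebyshev partial sums in the angle. -/
theorem partialSum_conj_torus (N : ℕ) {f : SU2 → ℝ} (hf : Continuous f)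
    (hc : ∀ x y, f (y * x * y⁻¹) = f x) (h : SU2) (θ : ℝ) :
    partialSum N f (h * torus θ * h⁻¹) =
      (chebyshevPartialSum N (fun t => f (torus t)) θ : ℂ) := by
  have hF : Continuous fun t => f (torus t) := hf.comp continuous_torus
  have hcoef (n : ℕ) : ∫ y, (irrep n).character y * (f y : ℂ) ∂haar =
      ((2 / Real.pi * ∫ t in (0)..Real.pi, f (torus t) *
        (Polynomial.Chebyshev.U ℝ n).eval (Real.cos t) * Real.sin t ^ 2 : ℝ) : ℂ) := by
    have := integral_comp_halfTrace
      (φ := fun c => (Polynomial.Chebyshev.U ℝ n).eval c * f (torus (Real.arccos c)))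
      (by
        have := hF.comp Real.continuous_arccos
        exact ((Polynomial.continuous _).mul this).continuousOn)
    have hR : ∫ t in (0)..Real.pi, f (torus t) *
        (Polynomial.Chebyshev.U ℝ n).eval (Real.cos t) * Real.sin t ^ 2 =
        ∫ t in (0)..Real.pi, (Polynomial.Chebyshev.U ℝ n).eval (Real.cos t) *
          f (torus (Real.arccos (Real.cos t))) * Real.sin t ^ 2 := by
      refine intervalIntegral.integral_congr fun t ht => ?_
      rw [Set.uIcc_of_le Real.pi_pos.le] at ht
      rw [Real.arccos_cos ht.1 ht.2, mul_comm (f (torus t))]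
    rw [hR, ← this, ← integral_complex_ofReal]
    congr 1
    ext y
    rw [character_eq_chebyshevU, eq_torus_arccos_halfTrace hc y]
    push_cast
    rfl
  have hterm (n : ℕ) (x : SU2) :
      ∫ y, ((n : ℂ) + 1) * (irrep n).character y * (f (y⁻¹ * x) : ℂ) ∂haar =
      (irrep n).character x * ∫ y, (irrep n).character y * (f y : ℂ) ∂haar := by
    simp only [mul_assoc]
    rw [integral_const_mul, integral_character_mul_central n hf hc]
    have hn : (n : ℂ) + 1 ≠ 0 := by exact_mod_cast n.succ_ne_zero
    field_simp
  simp only [partialSum, dirichletKernel, Finset.sum_mul]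
  rw [integral_finsetSum _ fun n _ => integrable_of_continuous
    (by have := continuous_character n; fun_prop)]
  simp only [hterm, hcoef]
  simp only [character_eq_chebyshevU, halfTrace_conj, halfTrace_torus]
  have hint (n : ℕ) : IntervalIntegrable (fun t => f (torus t) *
      ((Polynomial.Chebyshev.U ℝ n).eval (Real.cos θ) *
        (Polynomial.Chebyshev.U ℝ n).eval (Real.cos t)) * Real.sin t ^ 2) volume 0 Real.pi :=
    ((hF.mul (by fun_prop)).mul (by fun_prop)).intervalIntegrable _ _
  rw [chebyshevPartialSum]
  simp only [Finset.mul_sum, Finset.sum_mul]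
  rw [intervalIntegral.integral_finsetSum fun n _ => hint n, Finset.mul_sum, Complex.ofReal_sum]
  refine Finset.sum_congr rfl fun n _ => ?_
  rw [← Complex.ofReal_mul, mul_left_comm]
  congr 2
  refine (intervalIntegral.integral_const_mul _ _).symm.trans
    (intervalIntegral.integral_congr fun t _ => ?_)
  ring

end SU2

/-! ### A uniform Riemann–Lebesgue lemma for weakly singular kernels -/

section

open Real

theorem tendsto_integral_mul_exp_atTop (f : ℝ → ℂ) :
    Tendsto (fun w : ℝ => ∫ u, f u * Complex.exp (w * u * Complex.I)) atTop (𝓝 0) := by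
  have h := Real.tendsto_integral_exp_smul_cocompact f
  have hw : Tendsto (fun w : ℝ => -w / (2 * π)) atTop (cocompact ℝ) := by
    rw [cocompact_eq_atBot_atTop]
    exact (tendsto_neg_atTop_atBot.atBot_div_const (by positivity)).mono_right le_sup_left
  refine (h.comp hw).congr fun w => ?_
  refine integral_congr_ae (Eventually.of_forall fun u => ?_)
  simp only [Circle.smul_def, Real.fourierChar_apply, smul_eq_mul]
  rw [mul_comm]
  congr 2
  push_cast
  have := Complex.ofReal_ne_zero.2 Real.pi_ne_zero
  field_simp

/-- A kernel on `[0, π]²`, continuous off the diagonal, whose singularity on the diagonal is no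
worse than `|t - θ| ^ r`. -/
structure IsWeaklySingular (r : ℝ) (Φ : ℝ → ℝ → ℝ) : Prop where
  measurable (θ : ℝ) : Measurable (Φ θ)
  bound : ∃ C, 0 ≤ C ∧ ∀ θ ∈ Set.Icc 0 π, ∀ t ∈ Set.Icc 0 π, |Φ θ t| ≤ C * |t - θ| ^ r
  continuousAt (θ t : ℝ) (hθ : θ ∈ Set.Icc 0 π) (ht : t ∈ Set.Ioo 0 π) (h : t ≠ θ) :
    ContinuousAt (fun p : ℝ × ℝ => Φ p.1 p.2) (θ, t)

theorem intervalIntegrable_abs_rpow {r : ℝ} (hr : -1 < r) (a b : ℝ) :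
    IntervalIntegrable (fun u => |u| ^ r) volume a b := by
  have key₀ (c : ℝ) (h : 0 ≤ c) : IntervalIntegrable (fun u => |u| ^ r) volume 0 c := by
    refine (intervalIntegral.intervalIntegrable_rpow' hr).congr fun u hu => ?_
    rw [Set.uIoc_of_le h] at hu
    simp only [abs_of_pos hu.1]
  have key (c : ℝ) : IntervalIntegrable (fun u => |u| ^ r) volume 0 c := by
    rcases le_total 0 c with h | h
    · exact key₀ c h
    · rw [IntervalIntegrable.iff_comp_neg]
      simpa using key₀ (-c) (by linarith)
  exact (key a).symm.trans (key b)

namespace IsWeaklySingular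

variable {r : ℝ} {Φ : ℝ → ℝ → ℝ}

theorem intervalIntegrable (hΦ : IsWeaklySingular r Φ) (hr : -1 < r) {θ : ℝ}
    (hθ : θ ∈ Set.Icc 0 π) : IntervalIntegrable (Φ θ) volume 0 π := by
  obtain ⟨C, -, hC⟩ := hΦ.bound
  have h1 : IntervalIntegrable (fun t => C * |t - θ| ^ r) volume 0 π := by
    have := (intervalIntegrable_abs_rpow hr (0 - θ) (π - θ)).comp_sub_right θ
    simpa using this.const_mul C
  refine h1.mono_fun (hΦ.measurable θ).aestronglyMeasurable ?_
  rw [EventuallyLE, ae_restrict_iff' measurableSet_uIoc]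
  refine Eventually.of_forall fun t ht => ?_
  rw [Set.uIoc_of_le pi_pos.le] at ht
  exact (hC θ hθ t ⟨ht.1.le, ht.2⟩).trans (le_abs_self _)

/-- The kernel extended by zero and translated, so that its singularity sits at `u = 0`. -/
noncomputable def shift (Φ : ℝ → ℝ → ℝ) (θ u : ℝ) : ℝ :=
  (Set.Ioc 0 π).indicator (Φ θ) (θ + u)

theorem measurable_shift (hΦ : IsWeaklySingular r Φ) (θ : ℝ) : Measurable (shift Φ θ) :=
  ((hΦ.measurable θ).indicator measurableSet_Ioc).comp (measurable_const_add θ)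

theorem exists_integrable_abs_shift_le (hΦ : IsWeaklySingular r Φ) (hr : -1 < r) :
    ∃ g : ℝ → ℝ, Integrable g ∧ ∀ θ ∈ Set.Icc 0 π, ∀ u, |shift Φ θ u| ≤ g u := by
  obtain ⟨C, hC0, hC⟩ := hΦ.bound
  refine ⟨(Set.Ioc (-π) π).indicator fun u => C * |u| ^ r, ?_, fun θ hθ u => ?_⟩
  · rw [integrable_indicator_iff measurableSet_Ioc,
      ← intervalIntegrable_iff_integrableOn_Ioc_of_le (by linarith [pi_pos])]
    exact (intervalIntegrable_abs_rpow hr _ _).const_mul C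
  · have hnn : 0 ≤ C * |u| ^ r := mul_nonneg hC0 (rpow_nonneg (abs_nonneg u) r)
    rw [shift]
    by_cases h : θ + u ∈ Set.Ioc 0 π
    · rw [Set.indicator_of_mem h]
      by_cases hu : u ∈ Set.Ioc (-π) π
      · rw [Set.indicator_of_mem hu]
        simpa using hC θ hθ (θ + u) ⟨h.1.le, h.2⟩
      · exact absurd ⟨by linarith [h.1, hθ.2], by linarith [h.2, hθ.1]⟩ hu
    · rw [Set.indicator_of_notMem h, abs_zero]
      exact Set.indicator_apply_nonneg fun _ => hnn

theorem integrable_shift (hΦ : IsWeaklySingular r Φ) (hr : -1 < r) {θ : ℝ}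
    (hθ : θ ∈ Set.Icc 0 π) : Integrable (shift Φ θ) := by
  obtain ⟨g, hg, hgb⟩ := hΦ.exists_integrable_abs_shift_le hr
  exact hg.mono' (hΦ.measurable_shift θ).aestronglyMeasurable
    (Eventually.of_forall (hgb θ hθ))

theorem tendsto_shift (hΦ : IsWeaklySingular r Φ) {θ : ℝ} (hθ : θ ∈ Set.Icc 0 π) :
    ∀ᵐ u, Tendsto (fun θ' => shift Φ θ' u) (𝓝 θ) (𝓝 (shift Φ θ u)) := by
  have hfin : ({0, -θ, π - θ} : Set ℝ).Finite := by simp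
  filter_upwards [hfin.countable.ae_notMem volume] with u hu
  simp only [Set.mem_insert_iff, Set.mem_singleton_iff, not_or] at hu
  have hadd : Tendsto (fun θ' => θ' + u) (𝓝 θ) (𝓝 (θ + u)) :=
    (continuous_id.add continuous_const).tendsto θ
  by_cases h : θ + u ∈ Set.Ioo 0 π
  · have h1 : shift Φ θ u = Φ θ (θ + u) :=
      Set.indicator_of_mem (Set.Ioo_subset_Ioc_self h) _
    have h2 : ∀ᶠ θ' in 𝓝 θ, Φ θ' (θ' + u) = shift Φ θ' u := by
      filter_upwards [hadd.eventually (isOpen_Ioo.mem_nhds h)] with θ' h'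
      exact (Set.indicator_of_mem (Set.Ioo_subset_Ioc_self h') _).symm
    rw [h1]
    have h3 := hΦ.continuousAt θ (θ + u) hθ h (by simpa using hu.1)
    have h4 : Tendsto (fun θ' : ℝ => (θ', θ' + u)) (𝓝 θ) (𝓝 (θ, θ + u)) :=
      tendsto_id.prodMk_nhds hadd
    exact Tendsto.congr' h2 (h3.tendsto.comp h4)
  · have h' : θ + u ∈ (Set.Icc 0 π)ᶜ := by
      rintro ⟨h0, h1⟩
      refine h ⟨h0.lt_of_ne fun e => hu.2.1 (by linarith), h1.lt_of_ne fun e => hu.2.2 ?_⟩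
      linarith
    have h1 : ∀ᶠ θ' in 𝓝 θ, shift Φ θ' u = 0 := by
      filter_upwards [hadd.eventually (isClosed_Icc.isOpen_compl.mem_nhds h')] with θ' h''
      exact Set.indicator_of_notMem (fun hm => h'' (Set.Ioc_subset_Icc_self hm)) _
    rw [h1.self_of_nhds]
    exact Tendsto.congr' (h1.mono fun _ e => e.symm) tendsto_const_nhds

theorem norm_integral_mul_exp (θ w : ℝ) :
    ‖∫ t in (0)..π, (Φ θ t : ℂ) * Complex.exp (w * t * Complex.I)‖ =
      ‖∫ u, (shift Φ θ u : ℂ) * Complex.exp (w * u * Complex.I)‖ := by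
  have h1 : ∫ t in (0)..π, (Φ θ t : ℂ) * Complex.exp (w * t * Complex.I) =
      ∫ t, (((Set.Ioc 0 π).indicator (Φ θ) t : ℝ) : ℂ) * Complex.exp (w * t * Complex.I) := by
    rw [intervalIntegral.integral_of_le pi_pos.le, ← integral_indicator measurableSet_Ioc]
    congr 1
    ext t
    by_cases h : t ∈ Set.Ioc 0 π <;> simp [h]
  have h2 : ∫ t, (((Set.Ioc 0 π).indicator (Φ θ) t : ℝ) : ℂ) * Complex.exp (w * t * Complex.I) =
      Complex.exp ((w * θ : ℝ) * Complex.I) *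
        ∫ u, (shift Φ θ u : ℂ) * Complex.exp (w * u * Complex.I) := by
    rw [← integral_add_left_eq_self _ θ, ← integral_const_mul]
    congr 1
    ext u
    have : Complex.exp (w * ((θ + u : ℝ) : ℂ) * Complex.I) =
        Complex.exp ((w * θ : ℝ) * Complex.I) * Complex.exp (w * u * Complex.I) := by
      rw [← Complex.exp_add]
      push_cast
      ring_nf
    rw [this, shift]
    ring
  rw [h1, h2, norm_mul, Complex.norm_exp_ofReal_mul_I, one_mul]

/-- After the translation the kernel depends continuously on `θ` in `L¹`, and the oscillatory
integrals are equicontinuous on `L¹`; compactness of `[0, π]` makes the Riemann–Lebesgue lemma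
uniform. -/
theorem tendstoUniformlyOn_integral_mul_exp (hΦ : IsWeaklySingular r Φ) (hr : -1 < r) :
    TendstoUniformlyOn
      (fun (w θ : ℝ) => ∫ t in (0)..π, (Φ θ t : ℂ) * Complex.exp (w * t * Complex.I))
      (fun _ => 0) atTop (Set.Icc 0 π) := by
  obtain ⟨g, hg, hgb⟩ := hΦ.exists_integrable_abs_shift_le hr
  rw [← tendstoLocallyUniformlyOn_iff_tendstoUniformlyOn_of_compact isCompact_Icc,
    Metric.tendstoLocallyUniformlyOn_iff]
  intro ε hε θ₀ hθ₀
  have hL1 : Tendsto (fun θ => ∫ u, |shift Φ θ u - shift Φ θ₀ u|) (𝓝[Set.Icc 0 π] θ₀)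
      (𝓝 (∫ _u : ℝ, (0 : ℝ))) := by
    refine tendsto_integral_filter_of_dominated_convergence (fun u => g u + g u) ?_ ?_
      (hg.add hg) ?_
    · exact Eventually.of_forall fun θ =>
        ((hΦ.measurable_shift θ).sub (hΦ.measurable_shift θ₀)).abs.aestronglyMeasurable
    · filter_upwards [self_mem_nhdsWithin] with θ hθ
      refine Eventually.of_forall fun u => ?_
      rw [norm_eq_abs, abs_abs]
      exact (abs_sub _ _).trans (add_le_add (hgb θ hθ u) (hgb θ₀ hθ₀ u))
    · filter_upwards [hΦ.tendsto_shift hθ₀] with u hu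
      simpa using ((hu.mono_left nhdsWithin_le_nhds).sub_const (shift Φ θ₀ u)).abs
  rw [integral_zero] at hL1
  refine ⟨{θ | ∫ u, |shift Φ θ u - shift Φ θ₀ u| < ε / 2} ∩ Set.Icc 0 π,
    inter_mem (hL1.eventually (gt_mem_nhds (half_pos hε))) self_mem_nhdsWithin, ?_⟩
  have hRL := tendsto_integral_mul_exp_atTop fun u => (shift Φ θ₀ u : ℂ)
  filter_upwards [Metric.tendsto_nhds.1 hRL (ε / 2) (half_pos hε)] with w hw
  rintro θ ⟨hθ, hθI⟩
  rw [dist_zero_left, norm_integral_mul_exp]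
  rw [dist_zero_right] at hw
  have hexp (u : ℝ) : ‖Complex.exp (w * u * Complex.I)‖ = 1 := by
    exact_mod_cast Complex.norm_exp_ofReal_mul_I (w * u)
  have hi {θ : ℝ} (hθ : θ ∈ Set.Icc 0 π) :
      Integrable fun u => (shift Φ θ u : ℂ) * Complex.exp (w * u * Complex.I) :=
    (hΦ.integrable_shift hr hθ).ofReal.mul_bdd (c := 1) (by fun_prop)
      (Eventually.of_forall fun u => (hexp u).le)
  have hdiff : ‖(∫ u, (shift Φ θ u : ℂ) * Complex.exp (w * u * Complex.I)) -
      ∫ u, (shift Φ θ₀ u : ℂ) * Complex.exp (w * u * Complex.I)‖ ≤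
      ∫ u, |shift Φ θ u - shift Φ θ₀ u| := by
    rw [← integral_sub (hi hθI) (hi hθ₀)]
    refine (norm_integral_le_integral_norm _).trans_eq ?_
    congr 1
    ext u
    rw [← sub_mul, norm_mul, hexp, mul_one, ← Complex.ofReal_sub, Complex.norm_real, norm_eq_abs]
  have hθ' : ∫ u, |shift Φ θ u - shift Φ θ₀ u| < ε / 2 := hθ
  have := norm_le_norm_add_norm_sub' (∫ u, (shift Φ θ u : ℂ) * Complex.exp (w * u * Complex.I))
    (∫ u, (shift Φ θ₀ u : ℂ) * Complex.exp (w * u * Complex.I))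
  linarith

theorem eventually_abs_integral_lt (hΦ : IsWeaklySingular r Φ) (hr : -1 < r) {ε : ℝ}
    (hε : 0 < ε) : ∀ᶠ m : ℕ in atTop, ∀ θ ∈ Set.Icc 0 π,
      |∫ t in (0)..π, Φ θ t * sin ((m + 1 / 2) * t)| < ε ∧
      |∫ t in (0)..π, Φ θ t * cos ((m + 1 / 2) * t)| < ε := by
  have hw : Tendsto (fun m : ℕ => (m : ℝ) + 1 / 2) atTop atTop :=
    tendsto_natCast_atTop_atTop.atTop_add tendsto_const_nhds
  have h := hw.eventually (Metric.tendstoUniformlyOn_iff.1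
    (hΦ.tendstoUniformlyOn_integral_mul_exp hr) ε hε)
  filter_upwards [h] with m hm θ hθ
  have hmθ := hm θ hθ
  rw [dist_zero_left] at hmθ
  have hi : IntervalIntegrable (fun t => (Φ θ t : ℂ) *
      Complex.exp (((m + 1 / 2 : ℝ) : ℂ) * t * Complex.I)) volume 0 π :=
    IntervalIntegrable.mul_continuousOn
      (let h := hΦ.intervalIntegrable hr hθ; ⟨h.1.ofReal, h.2.ofReal⟩) (by fun_prop)
  have he (t : ℝ) : ((m + 1 / 2 : ℝ) : ℂ) * t * Complex.I =
      (((m + 1 / 2) * t : ℝ) : ℂ) * Complex.I := by push_cast; ring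
  constructor
  · have : ∫ t in (0)..π, Φ θ t * sin ((m + 1 / 2) * t) =
        (∫ t in (0)..π, (Φ θ t : ℂ) *
          Complex.exp (((m + 1 / 2 : ℝ) : ℂ) * t * Complex.I)).im := by
      have := Complex.imCLM.intervalIntegral_comp_comm hi
      simp only [Complex.imCLM_apply, he, Complex.im_ofReal_mul,
        Complex.exp_ofReal_mul_I_im] at this
      simpa only [he] using this
    rw [this]
    exact (Complex.abs_im_le_norm _).trans_lt hmθ
  · have : ∫ t in (0)..π, Φ θ t * cos ((m + 1 / 2) * t) =
        (∫ t in (0)..π, (Φ θ t : ℂ) *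
          Complex.exp (((m + 1 / 2 : ℝ) : ℂ) * t * Complex.I)).re := by
      have := Complex.reCLM.intervalIntegral_comp_comm hi
      simp only [Complex.reCLM_apply, he, Complex.re_ofReal_mul,
        Complex.exp_ofReal_mul_I_re] at this
      simpa only [he] using this
    rw [this]
    exact (Complex.abs_re_le_norm _).trans_lt hmθ

end IsWeaklySingular

theorem cos_sub_cos_ne_zero {θ t : ℝ} (hθ : θ ∈ Set.Icc 0 π) (ht : t ∈ Set.Icc 0 π)
    (h : t ≠ θ) : cos θ - cos t ≠ 0 := fun h0 =>
  h (injOn_cos ht hθ (sub_eq_zero.1 h0).symm)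

theorem mul_sin_le_abs_cos_sub_cos {θ t : ℝ} (hθ : θ ∈ Set.Icc 0 π) (ht : t ∈ Set.Icc 0 π) :
    2 * |t - θ| * sin ((t + θ) / 2) ≤ π * |cos θ - cos t| := by
  have hs : 0 ≤ sin ((t + θ) / 2) :=
    sin_nonneg_of_nonneg_of_le_pi (by linarith [hθ.1, ht.1]) (by linarith [hθ.2, ht.2])
  have h1 : 2 / π * |(θ - t) / 2| ≤ |sin ((θ - t) / 2)| := by
    refine mul_abs_le_abs_sin ?_
    rw [abs_le]
    constructor <;> linarith [hθ.1, hθ.2, ht.1, ht.2]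
  rw [cos_sub_cos, abs_mul, abs_mul, abs_neg, abs_two, add_comm θ t, abs_of_nonneg hs]
  have h2 : |t - θ| ≤ π * |sin ((θ - t) / 2)| := by
    rw [abs_div, abs_two, abs_sub_comm θ t] at h1
    calc |t - θ| = π * (2 / π * (|t - θ| / 2)) := by field_simp
      _ ≤ _ := by gcongr
  nlinarith [mul_le_mul_of_nonneg_right h2 hs]

/-- A difference quotient of a Hölder function, weighted so that the zeros of `cos θ - cos t` off
the diagonal are cancelled, is weakly singular. -/
theorem isWeaklySingular_of_holder {α M : ℝ} {F : ℝ → ℝ} (hc : Continuous F)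
    (hF : ∀ s t, |F s - F t| ≤ M * |s - t| ^ α) (hM : 0 ≤ M) {a : ℝ → ℝ → ℝ}
    (ha : Continuous fun p : ℝ × ℝ => a p.1 p.2)
    (hle : ∀ θ ∈ Set.Icc 0 π, ∀ t ∈ Set.Icc 0 π, |a θ t| ≤ 2 * sin ((t + θ) / 2)) :
    IsWeaklySingular (α - 1) fun θ t => (F t - F θ) * a θ t / (cos θ - cos t) where
  measurable θ := by
    have : Continuous fun t => a θ t := ha.comp (by fun_prop : Continuous fun t => (θ, t))
    exact Measurable.div (by fun_prop) (by fun_prop)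
  bound := by
    refine ⟨M * π, by positivity, fun θ hθ t ht => ?_⟩
    by_cases h : t = θ
    · subst h
      simp only [sub_self, zero_mul, zero_div, abs_zero]
      positivity
    · have hpos : 0 < |t - θ| := abs_pos.2 (sub_ne_zero.2 h)
      have hden : 0 < |cos θ - cos t| := abs_pos.2 (cos_sub_cos_ne_zero hθ ht h)
      rw [abs_div, abs_mul, div_le_iff₀ hden, rpow_sub_one hpos.ne']
      have h1 : |a θ t| ≤ π * |cos θ - cos t| / |t - θ| := by
        rw [le_div_iff₀ hpos]
        nlinarith [mul_sin_le_abs_cos_sub_cos hθ ht, hle θ hθ t ht]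
      calc |F t - F θ| * |a θ t|
          ≤ (M * |t - θ| ^ α) * (π * |cos θ - cos t| / |t - θ|) := by
            gcongr
            exact hF t θ
        _ = _ := by ring
  continuousAt θ t hθ ht h := by
    have : cos θ - cos t ≠ 0 := cos_sub_cos_ne_zero hθ (Set.Ioo_subset_Icc_self ht) h
    exact ContinuousAt.div (by fun_prop) (by fun_prop) this

end

/-! ### The remainder of the Chebyshev partial sums -/

section

open Real Polynomial.Chebyshev

/-- The Christoffel–Darboux identity. Indices are integers, so that `U (m - 1)` is `U (-1) = 0` when
`m = 0`. -/
theorem christoffelDarboux_chebyshevU (m : ℕ) (x t : ℝ) :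
    (x - cos t) * ∑ k ∈ Finset.range m, (U ℝ k).eval x * sin ((k + 1) * t) =
      ((U ℝ m).eval x * sin (m * t) - (U ℝ ((m : ℤ) - 1)).eval x * sin ((m + 1) * t)) / 2 := by
  induction m with
  | zero => simp
  | succ m ih =>
    have hU : (U ℝ (m + 1 : ℕ)).eval x =
        2 * x * (U ℝ m).eval x - (U ℝ ((m : ℤ) - 1)).eval x := by
      push_cast
      rw [U_add_one]
      simp
    have hs : sin ((m + 1 + 1) * t) + sin (m * t) = 2 * cos t * sin ((m + 1) * t) := by
      have h1 : ((m : ℝ) + 1 + 1) * t = (m + 1) * t + t := by ring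
      have h2 : (m : ℝ) * t = (m + 1) * t - t := by ring
      rw [h1, h2, sin_add, sin_sub]
      ring
    have hm : (((m + 1 : ℕ) : ℤ) - 1) = m := by push_cast; ring
    rw [Finset.sum_range_succ, mul_add, ih, hU, hm]
    push_cast
    linear_combination ((U ℝ m).eval x / 2) * hs

theorem cos_half_mul_chebyshevU_sub (m : ℕ) (θ : ℝ) :
    cos (θ / 2) * ((U ℝ m).eval (cos θ) - (U ℝ ((m : ℤ) - 1)).eval (cos θ)) =
      cos ((m + 1 / 2) * θ) := by
  induction m using Nat.twoStepInduction with
  | zero => simp; ring_nf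
  | one =>
    have h1 : ((1 : ℕ) + 1 / 2 : ℝ) * θ = θ + θ / 2 := by push_cast; ring
    have h2 : cos θ = 2 * cos (θ / 2) ^ 2 - 1 := by rw [← cos_two_mul]; ring_nf
    have h3 : sin θ = 2 * sin (θ / 2) * cos (θ / 2) := by rw [← sin_two_mul]; ring_nf
    rw [h1, cos_add, h3, h2]
    simp
    linear_combination (2 * cos (θ / 2)) * sin_sq_add_cos_sq (θ / 2)
  | more m ih₀ ih₁ =>
    have h1 : ((m + 2 : ℕ) + 1 / 2 : ℝ) * θ = ((m + 1 : ℕ) + 1 / 2) * θ + θ := by push_cast; ring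
    have h2 : ((m : ℝ) + 1 / 2) * θ = ((m + 1 : ℕ) + 1 / 2) * θ - θ := by push_cast; ring
    have h3 : cos (((m + 2 : ℕ) + 1 / 2 : ℝ) * θ) =
        2 * cos θ * cos (((m + 1 : ℕ) + 1 / 2) * θ) - cos ((m + 1 / 2) * θ) := by
      rw [h1, h2, cos_add, cos_sub]
      ring
    rw [h3, ← ih₀, ← ih₁]
    have e1 : ((m + 2 : ℕ) : ℤ) = (m : ℤ) + 2 := by push_cast; ring
    have e2 : (m : ℤ) + 2 - 1 = m + 1 := by ring
    have e3 : (((m + 1 : ℕ) : ℤ) - 1) = m := by push_cast; ring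
    rw [e1, e2, e3, U_add_two]
    push_cast
    rw [U_add_one]
    simp
    ring

theorem chebyshevU_add_succ (m : ℕ) (θ : ℝ) :
    (U ℝ (m + 1 : ℕ)).eval (cos θ) + (U ℝ (((m + 1 : ℕ) : ℤ) - 1)).eval (cos θ) =
      (U ℝ m).eval (cos θ) + (U ℝ ((m : ℤ) - 1)).eval (cos θ) + 2 * cos ((m + 1) * θ) := by
  have h := congr_arg (Polynomial.eval (cos θ)) (two_mul_T_eq_U_sub_U ℝ ((m : ℤ) - 1))
  have e1 : (m : ℤ) - 1 + 2 = (m + 1 : ℕ) := by push_cast; ring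
  have e2 : (((m + 1 : ℕ) : ℤ) - 1) = m := by push_cast; ring
  rw [e1] at h
  rw [e2]
  simp only [Polynomial.eval_mul, Polynomial.eval_sub, Polynomial.eval_ofNat, T_real_cos] at h
  push_cast at h ⊢
  linarith

theorem sin_half_mul_chebyshevU_add (m : ℕ) (θ : ℝ) :
    sin (θ / 2) * ((U ℝ m).eval (cos θ) + (U ℝ ((m : ℤ) - 1)).eval (cos θ)) =
      sin ((m + 1 / 2) * θ) := by
  induction m with
  | zero => simp; ring_nf
  | succ m ih =>
    have h1 : ((m + 1 : ℕ) + 1 / 2 : ℝ) * θ = (m + 1) * θ + θ / 2 := by push_cast; ring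
    have h2 : ((m : ℝ) + 1 / 2) * θ = (m + 1) * θ - θ / 2 := by ring
    rw [chebyshevU_add_succ, mul_add, ih, h1, h2, sin_add, sin_sub]
    ring

theorem abs_chebyshevU_add_le (m : ℕ) (θ : ℝ) :
    |(U ℝ m).eval (cos θ) + (U ℝ ((m : ℤ) - 1)).eval (cos θ)| ≤ 2 * m + 1 := by
  induction m with
  | zero => simp
  | succ m ih =>
    rw [chebyshevU_add_succ]
    refine (abs_add_le _ _).trans ?_
    rw [abs_mul, abs_two]
    have := abs_cos_le_one ((m + 1) * θ)
    push_cast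
    linarith

open SU2 (chebyshevPartialSum)

theorem chebyshevPartialSum_const (N : ℕ) (c θ : ℝ) :
    chebyshevPartialSum N (fun _ => c) θ = c := by
  have h (t : ℝ) : c * (∑ n ∈ Finset.range (N + 1), (U ℝ n).eval (cos θ) *
      (U ℝ n).eval (cos t)) * sin t ^ 2 = ∑ n ∈ Finset.range (N + 1),
      c * (U ℝ n).eval (cos θ) * ((U ℝ n).eval (cos t) * sin t ^ 2) := by
    rw [Finset.mul_sum, Finset.sum_mul]
    exact Finset.sum_congr rfl fun n _ => by ring
  simp only [chebyshevPartialSum, h]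
  rw [intervalIntegral.integral_finsetSum fun n _ =>
    (by fun_prop : Continuous _).intervalIntegrable _ _]
  simp only [intervalIntegral.integral_const_mul, integral_chebyshevU_cos_mul_sin_sq]
  rw [Finset.sum_eq_single 0 (fun n _ hn => by simp [hn]) (by simp)]
  have := pi_ne_zero
  simp
  field_simp

theorem sin_le_two_mul_sin {θ t : ℝ} (hθ : θ ∈ Set.Icc 0 π) (ht : t ∈ Set.Icc 0 π) :
    sin t ≤ 2 * sin ((t + θ) / 2) := by
  have h1 : sin t + sin θ = 2 * sin ((t + θ) / 2) * cos ((t - θ) / 2) := sin_add_sin t θ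
  have h2 : 0 ≤ sin θ := sin_nonneg_of_nonneg_of_le_pi hθ.1 hθ.2
  have h3 : 0 ≤ sin ((t + θ) / 2) :=
    sin_nonneg_of_nonneg_of_le_pi (by linarith [hθ.1, ht.1]) (by linarith [hθ.2, ht.2])
  nlinarith [cos_le_one ((t - θ) / 2)]

variable {α M : ℝ} {F : ℝ → ℝ}

theorem isWeaklySingular_sin_mul (hc : Continuous F)
    (hF : ∀ s t, |F s - F t| ≤ M * |s - t| ^ α) (hM : 0 ≤ M) {b : ℝ → ℝ} (hb : Continuous b)
    (hb1 : ∀ t, |b t| ≤ 1) :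
    IsWeaklySingular (α - 1) fun θ t => (F t - F θ) * (sin t * b t) / (cos θ - cos t) := by
  refine isWeaklySingular_of_holder hc hF hM (a := fun _ t => sin t * b t) (by fun_prop)
    fun θ hθ t ht => ?_
  have h := sin_nonneg_of_nonneg_of_le_pi ht.1 ht.2
  rw [abs_mul, abs_of_nonneg h]
  exact (mul_le_of_le_one_right h (hb1 t)).trans (sin_le_two_mul_sin hθ ht)

theorem isWeaklySingular_sin_half (hc : Continuous F)
    (hF : ∀ s t, |F s - F t| ≤ M * |s - t| ^ α) (hM : 0 ≤ M) :
    IsWeaklySingular (α - 1)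
      fun θ t => (F t - F θ) * (sin (θ / 2) * cos (t / 2)) / (cos θ - cos t) := by
  refine isWeaklySingular_of_holder hc hF hM (a := fun θ t => sin (θ / 2) * cos (t / 2))
    (by fun_prop) fun θ hθ t ht => ?_
  have h1 : 0 ≤ sin (θ / 2) :=
    sin_nonneg_of_nonneg_of_le_pi (by linarith [hθ.1]) (by linarith [hθ.2, pi_pos])
  have h2 : 0 ≤ cos (t / 2) :=
    cos_nonneg_of_mem_Icc ⟨by linarith [ht.1, pi_pos], by linarith [ht.2]⟩
  have h3 : 0 ≤ sin (t / 2) :=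
    sin_nonneg_of_nonneg_of_le_pi (by linarith [ht.1]) (by linarith [ht.2, pi_pos])
  have h4 : 0 ≤ cos (θ / 2) :=
    cos_nonneg_of_mem_Icc ⟨by linarith [hθ.1, pi_pos], by linarith [hθ.2]⟩
  rw [abs_of_nonneg (mul_nonneg h1 h2), add_div, sin_add]
  nlinarith [mul_nonneg h3 h4, mul_nonneg h1 h2]

/-- The sine-type oscillatory integral in the remainder of the partial sum of order `m - 1`. The
integrand takes the junk value `0` at `t = θ`. -/
noncomputable def sinRemainder (F : ℝ → ℝ) (m : ℕ) (θ : ℝ) : ℝ :=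
  ∫ t in (0)..π, (F t - F θ) * (sin t * cos (t / 2)) / (cos θ - cos t) * sin ((m + 1 / 2) * t)

/-- The cosine-type oscillatory integral in the remainder of the partial sum of order `m - 1`. The
integrand takes the junk value `0` at `t = θ`. -/
noncomputable def cosRemainder (F : ℝ → ℝ) (m : ℕ) (θ : ℝ) : ℝ :=
  ∫ t in (0)..π, (F t - F θ) * (sin t * sin (t / 2)) / (cos θ - cos t) * cos ((m + 1 / 2) * t)

theorem ae_mem_Icc_and_ne (θ : ℝ) :
    ∀ᵐ t : ℝ, t ∈ Set.uIoc 0 π → t ∈ Set.Icc 0 π ∧ t ≠ 0 ∧ t ≠ θ := by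
  filter_upwards [(Set.countable_singleton θ).ae_notMem volume] with t ht h
  rw [Set.uIoc_of_le pi_pos.le] at h
  exact ⟨Set.Ioc_subset_Icc_self h, h.1.ne', ht⟩

/-- The remainder formula: as the partial sums reproduce constants, `F t` may be replaced by
`F t - F θ`, after which the Christoffel–Darboux quotient is integrable. -/
theorem chebyshevPartialSum_sub (hα : 0 < α) (hc : Continuous F)
    (hF : ∀ s t, |F s - F t| ≤ M * |s - t| ^ α) (hM : 0 ≤ M) (N : ℕ) {θ : ℝ}
    (hθ : θ ∈ Set.Icc 0 π) :
    chebyshevPartialSum N F θ - F θ = 1 / π *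
      (((U ℝ (N + 1 : ℕ)).eval (cos θ) - (U ℝ (((N + 1 : ℕ) : ℤ) - 1)).eval (cos θ)) *
          sinRemainder F (N + 1) θ -
        ((U ℝ (N + 1 : ℕ)).eval (cos θ) + (U ℝ (((N + 1 : ℕ) : ℤ) - 1)).eval (cos θ)) *
          cosRemainder F (N + 1) θ) := by
  have hr : -1 < α - 1 := by linarith
  have hA := (isWeaklySingular_sin_mul hc hF hM (b := fun t => cos (t / 2)) (by fun_prop)
    fun t => abs_cos_le_one _).intervalIntegrable hr hθ
  have hB := (isWeaklySingular_sin_mul hc hF hM (b := fun t => sin (t / 2)) (by fun_prop)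
    fun t => abs_sin_le_one _).intervalIntegrable hr hθ
  have hA' := hA.mul_continuousOn (g := fun t => sin (((N + 1 : ℕ) + 1 / 2) * t)) (by fun_prop)
  have hB' := hB.mul_continuousOn (g := fun t => cos (((N + 1 : ℕ) + 1 / 2) * t)) (by fun_prop)
  set Wm := (U ℝ (N + 1 : ℕ)).eval (cos θ) - (U ℝ (((N + 1 : ℕ) : ℤ) - 1)).eval (cos θ) with hWm
  set Wp := (U ℝ (N + 1 : ℕ)).eval (cos θ) + (U ℝ (((N + 1 : ℕ) : ℤ) - 1)).eval (cos θ) with hWp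
  have hrem := intervalIntegral.integral_sub (hA'.const_mul Wm) (hB'.const_mul Wp)
  rw [intervalIntegral.integral_const_mul, intervalIntegral.integral_const_mul] at hrem
  conv_lhs => rw [← chebyshevPartialSum_const N (F θ) θ]
  rw [sinRemainder, cosRemainder, ← hrem, chebyshevPartialSum, chebyshevPartialSum, ← mul_sub,
    ← intervalIntegral.integral_sub ((by fun_prop : Continuous _).intervalIntegrable _ _)
    ((by fun_prop : Continuous _).intervalIntegrable _ _),
    div_mul_eq_mul_div, div_mul_eq_mul_div, one_mul, ← intervalIntegral.integral_const_mul]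
  congr 1
  refine intervalIntegral.integral_congr_ae ?_
  filter_upwards [ae_mem_Icc_and_ne θ] with t h ht
  obtain ⟨htI, -, htθ⟩ := h ht
  have hden := cos_sub_cos_ne_zero hθ htI htθ
  have hCD := christoffelDarboux_chebyshevU (N + 1) (cos θ) t
  have hsum : (∑ n ∈ Finset.range (N + 1), (U ℝ n).eval (cos θ) * (U ℝ n).eval (cos t)) *
      sin t ^ 2 =
      sin t * ∑ n ∈ Finset.range (N + 1), (U ℝ n).eval (cos θ) * sin ((n + 1) * t) := by
    rw [Finset.sum_mul, Finset.mul_sum]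
    refine Finset.sum_congr rfl fun n _ => ?_
    have := U_real_cos t n
    rw [Int.cast_natCast] at this
    rw [← this]
    ring
  have h1 : ((N + 1 : ℕ) : ℝ) * t = ((N + 1 : ℕ) + 1 / 2) * t - t / 2 := by ring
  have h2 : (((N + 1 : ℕ) : ℝ) + 1) * t = ((N + 1 : ℕ) + 1 / 2) * t + t / 2 := by ring
  rw [h1, h2, sin_sub, sin_add] at hCD
  simp only [mul_assoc]
  rw [hsum, hWm, hWp]
  generalize sin (((N + 1 : ℕ) + 1 / 2) * t) = S at hCD ⊢
  generalize cos (((N + 1 : ℕ) + 1 / 2) * t) = S' at hCD ⊢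
  generalize ∑ n ∈ Finset.range (N + 1), (U ℝ n).eval (cos θ) * sin ((n + 1) * t) = K at hCD ⊢
  field_simp
  linear_combination (2 * (F t - F θ) * sin t) * hCD

theorem eventually_abs_remainder_lt (hα : 0 < α) (hc : Continuous F)
    (hF : ∀ s t, |F s - F t| ≤ M * |s - t| ^ α) (hM : 0 ≤ M) {ε : ℝ} (hε : 0 < ε) :
    ∀ᶠ m : ℕ in atTop, ∀ θ ∈ Set.Icc 0 π,
      |sinRemainder F m θ| < ε ∧ |cosRemainder F m θ| < ε := by
  have hr : -1 < α - 1 := by linarith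
  filter_upwards [(isWeaklySingular_sin_mul hc hF hM (b := fun t => cos (t / 2)) (by fun_prop)
    fun t => abs_cos_le_one _).eventually_abs_integral_lt hr hε,
    (isWeaklySingular_sin_mul hc hF hM (b := fun t => sin (t / 2)) (by fun_prop)
    fun t => abs_sin_le_one _).eventually_abs_integral_lt hr hε] with m h1 h2 θ hθ
  exact ⟨(h1 θ hθ).1, (h2 θ hθ).2⟩

/-- Away from the zeros of `sin θ` the partial sums converge uniformly. -/
theorem eventually_sin_mul_abs_lt (hα : 0 < α) (hc : Continuous F)
    (hF : ∀ s t, |F s - F t| ≤ M * |s - t| ^ α) (hM : 0 ≤ M) {ε : ℝ} (hε : 0 < ε) :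
    ∀ᶠ N : ℕ in atTop, ∀ θ ∈ Set.Icc 0 π, sin θ * |chebyshevPartialSum N F θ - F θ| < ε := by
  have h := (tendsto_add_atTop_nat 1).eventually
    (eventually_abs_remainder_lt hα hc hF hM (half_pos hε))
  filter_upwards [h] with N hN θ hθ
  obtain ⟨h1, h2⟩ := hN θ hθ
  have hs : sin θ = 2 * sin (θ / 2) * cos (θ / 2) := by rw [← sin_two_mul]; ring_nf
  have hs0 : 0 ≤ sin θ := sin_nonneg_of_nonneg_of_le_pi hθ.1 hθ.2
  have key : sin θ * (chebyshevPartialSum N F θ - F θ) = 2 / π *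
      (sin (θ / 2) * cos (((N + 1 : ℕ) + 1 / 2) * θ) * sinRemainder F (N + 1) θ -
        cos (θ / 2) * sin (((N + 1 : ℕ) + 1 / 2) * θ) * cosRemainder F (N + 1) θ) := by
    rw [chebyshevPartialSum_sub hα hc hF hM N hθ, ← cos_half_mul_chebyshevU_sub,
      ← sin_half_mul_chebyshevU_add, hs]
    ring
  have hb {x y z : ℝ} (hx : |x| ≤ 1) (hy : |y| ≤ 1) : |x * y * z| ≤ |z| := by
    rw [abs_mul, abs_mul]
    exact mul_le_of_le_one_left (abs_nonneg _) (mul_le_one₀ hx (abs_nonneg _) hy)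
  rw [← abs_of_nonneg hs0, ← abs_mul, key, abs_mul, abs_of_pos (by positivity)]
  have hpi : 2 / π ≤ 1 := by
    rw [div_le_one pi_pos]
    exact two_le_pi
  calc _ ≤ 1 * (|sinRemainder F (N + 1) θ| + |cosRemainder F (N + 1) θ|) := by
        gcongr
        refine (abs_sub _ _).trans (add_le_add ?_ ?_)
        · exact hb (abs_sin_le_one _) (abs_cos_le_one _)
        · exact hb (abs_cos_le_one _) (abs_sin_le_one _)
    _ < ε := by linarith

/-- The part of `cosRemainder F m θ` that is not already present at `θ = 0` carries a factor
`sin (θ / 2)`. The functions `cos (t / 2)` and `cos ((m + 1 / 2) t)` being orthogonal on `[0, π]`,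
the increment `F 0 - F θ` does not contribute. -/
theorem cosRemainder_eq (hα : 0 < α) (hc : Continuous F)
    (hF : ∀ s t, |F s - F t| ≤ M * |s - t| ^ α) (hM : 0 ≤ M) {m : ℕ} (hm : m ≠ 0) {θ : ℝ}
    (hθ : θ ∈ Set.Icc 0 π) :
    cosRemainder F m θ = cosRemainder F m 0 + 2 * sin (θ / 2) *
      ∫ t in (0)..π, (F t - F θ) * (sin (θ / 2) * cos (t / 2)) / (cos θ - cos t) *
        cos ((m + 1 / 2) * t) := by
  have hr : -1 < α - 1 := by linarith
  have h0 : (0 : ℝ) ∈ Set.Icc 0 π := ⟨le_rfl, pi_pos.le⟩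
  have hB := (isWeaklySingular_sin_mul hc hF hM (b := fun t => sin (t / 2)) (by fun_prop)
    fun t => abs_sin_le_one _).intervalIntegrable hr h0
  have hQ := (isWeaklySingular_sin_half hc hF hM).intervalIntegrable hr hθ
  have hB' := hB.mul_continuousOn (g := fun t => cos ((m + 1 / 2) * t)) (by fun_prop)
  have hQ' := hQ.mul_continuousOn (g := fun t => cos ((m + 1 / 2) * t)) (by fun_prop)
  have hcint (k : ℕ) (hk : k ≠ 0) : ∫ t in (0)..π, cos (k * t) = 0 := by
    rw [intervalIntegral.integral_comp_mul_left _ (by exact_mod_cast hk)]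
    simp
  have horth : ∫ t in (0)..π, (F 0 - F θ) * (cos (t / 2) * cos ((m + 1 / 2) * t)) = 0 := by
    have (t : ℝ) : cos (t / 2) * cos ((m + 1 / 2) * t) =
        (cos (m * t) + cos ((m + 1 : ℕ) * t)) / 2 := by
      have h1 : (m : ℝ) * t = (m + 1 / 2) * t - t / 2 := by ring
      have h2 : ((m + 1 : ℕ) : ℝ) * t = (m + 1 / 2) * t + t / 2 := by push_cast; ring
      rw [h1, h2, cos_sub, cos_add]
      ring
    simp only [this]
    rw [intervalIntegral.integral_const_mul, intervalIntegral.integral_div,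
      intervalIntegral.integral_add
      ((by fun_prop : Continuous _).intervalIntegrable _ _)
      ((by fun_prop : Continuous _).intervalIntegrable _ _), hcint m hm,
      hcint (m + 1) m.succ_ne_zero]
    simp
  have hI : IntervalIntegrable (fun t => (F 0 - F θ) * (cos (t / 2) * cos ((m + 1 / 2) * t)))
      volume 0 π := (by fun_prop : Continuous _).intervalIntegrable _ _
  have hrem := intervalIntegral.integral_add (hB'.add hI) (hQ'.const_mul (2 * sin (θ / 2)))
  rw [intervalIntegral.integral_add hB' hI, horth, add_zero,
    intervalIntegral.integral_const_mul] at hrem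
  rw [cosRemainder, cosRemainder, ← hrem]
  refine intervalIntegral.integral_congr_ae ?_
  filter_upwards [ae_mem_Icc_and_ne θ] with t h ht
  obtain ⟨htI, ht0, htθ⟩ := h ht
  have hden := cos_sub_cos_ne_zero hθ htI htθ
  have hden0 := cos_sub_cos_ne_zero h0 htI ht0
  have e1 : sin t * sin (t / 2) = (cos 0 - cos t) * cos (t / 2) := by
    have h1 : sin t = 2 * sin (t / 2) * cos (t / 2) := by rw [← sin_two_mul]; ring_nf
    have h2 : cos t = 1 - 2 * sin (t / 2) ^ 2 := by
      rw [sin_sq_eq_half_sub]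
      ring_nf
    rw [h1, h2, cos_zero]
    ring
  have e2 : cos 0 = cos θ + 2 * sin (θ / 2) ^ 2 := by
    rw [sin_sq_eq_half_sub, cos_zero]
    ring_nf
  have e3 : (F t - F 0) * (sin t * sin (t / 2)) / (cos 0 - cos t) =
      (F t - F 0) * cos (t / 2) := by
    rw [e1]
    field_simp
  rw [e3, e1, e2]
  field_simp
  ring

/-- If `m u_m` has a positive limit, then `∑ u_m` is unbounded, by comparison with the harmonic
series. -/
theorem nonpos_of_sum_range_le {u : ℕ → ℝ} {C L : ℝ}
    (hC : ∀ M, ∑ m ∈ Finset.range M, u m ≤ C)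
    (hu : Tendsto (fun m : ℕ => (2 * (m : ℝ) + 1) * u m) atTop (𝓝 L)) : L ≤ 0 := by
  by_contra! hL
  obtain ⟨m₀, hm₀⟩ := eventually_atTop.1 (hu.eventually (lt_mem_nhds (half_lt_self hL)))
  have hv : ∀ m ≥ m₀, 0 ≤ u m - L / 4 * (1 / (m + 1)) := by
    intro m hm
    have h1 := hm₀ m hm
    have h2 : (0 : ℝ) < 2 * m + 1 := by positivity
    have h3 : L / 4 * (1 / ((m : ℝ) + 1)) ≤ u m := by
      rw [mul_one_div, div_le_iff₀ (by positivity)]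
      have h4 : 0 ≤ u m := by
        by_contra! h
        nlinarith
      nlinarith
    linarith
  set D := ∑ m ∈ Finset.range m₀, (u m - L / 4 * (1 / ((m : ℝ) + 1)))
  have hD (M : ℕ) (hM : m₀ ≤ M) :
      D ≤ ∑ m ∈ Finset.range M, (u m - L / 4 * (1 / ((m : ℝ) + 1))) := by
    refine Finset.sum_le_sum_of_subset_of_nonneg (Finset.range_mono hM) fun m _ hm => hv m ?_
    simpa using hm
  obtain ⟨M, hM, hM'⟩ := ((tendsto_sum_range_one_div_nat_succ_atTop.eventually
    (eventually_gt_atTop ((C - D) / (L / 4)))).and (eventually_ge_atTop m₀)).exists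
  have h := hD M hM'
  rw [Finset.sum_sub_distrib, ← Finset.mul_sum] at h
  rw [div_lt_iff₀ (by positivity)] at hM
  linarith [hC M]

theorem sum_range_cos (M : ℕ) (t : ℝ) :
    2 * sin (t / 2) * ∑ m ∈ Finset.range M, cos ((m + 1 / 2) * t) = sin (M * t) := by
  induction M with
  | zero => simp
  | succ M ih =>
    have h1 : (M : ℝ) * t = (M + 1 / 2) * t - t / 2 := by ring
    have h2 : ((M + 1 : ℕ) : ℝ) * t = (M + 1 / 2) * t + t / 2 := by push_cast; ring
    rw [Finset.sum_range_succ, mul_add, ih, h1, h2, sin_add, sin_sub]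
    ring

/-- The sums of `cosRemainder F m 0` over `m` stay bounded: they are the Dirichlet integrals of a
Hölder function at one of its zeros. -/
theorem exists_abs_sum_cosRemainder_le (hα : 0 < α) (hc : Continuous F)
    (hF : ∀ s t, |F s - F t| ≤ M * |s - t| ^ α) (hM : 0 ≤ M) :
    ∃ C, ∀ K, |∑ m ∈ Finset.range K, cosRemainder F m 0| ≤ C := by
  have hr : -1 < α - 1 := by linarith
  have h0 : (0 : ℝ) ∈ Set.Icc 0 π := ⟨le_rfl, pi_pos.le⟩
  have hB := (isWeaklySingular_sin_mul hc hF hM (b := fun t => sin (t / 2)) (by fun_prop)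
    fun t => abs_sin_le_one _).intervalIntegrable hr h0
  have hD := (isWeaklySingular_sin_mul hc hF hM (b := fun _ => 1) (by fun_prop)
    fun t => by simp).intervalIntegrable hr h0
  refine ⟨∫ t in (0)..π, |(F t - F 0) * (sin t * 1) / (cos 0 - cos t)|, fun K => ?_⟩
  have hsum : ∑ m ∈ Finset.range K, cosRemainder F m 0 =
      ∫ t in (0)..π, (F t - F 0) * (sin t * 1) / (cos 0 - cos t) * (sin (K * t) / 2) := by
    simp only [cosRemainder]
    rw [← intervalIntegral.integral_finsetSum fun m _ => hB.mul_continuousOn (by fun_prop)]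
    refine intervalIntegral.integral_congr fun t _ => ?_
    rw [← Finset.mul_sum, ← sum_range_cos]
    ring
  rw [hsum]
  refine intervalIntegral.abs_integral_le_integral_abs pi_pos.le |>.trans ?_
  refine intervalIntegral.integral_mono_on pi_pos.le
    (hD.mul_continuousOn (by fun_prop)).abs hD.abs fun t _ => ?_
  rw [abs_mul]
  refine mul_le_of_le_one_right (abs_nonneg _) ?_
  rw [abs_div, abs_two]
  linarith [abs_sin_le_one (K * t)]

/-- If the partial sums converge at `θ = 0`, then `cosRemainder F m 0 = o(1 / m)`: otherwise these
numbers would be asymptotic to a multiple of `1 / m`, and their sums unbounded. -/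
theorem tendsto_mul_cosRemainder_zero (hα : 0 < α) (hc : Continuous F)
    (hF : ∀ s t, |F s - F t| ≤ M * |s - t| ^ α) (hM : 0 ≤ M) {a : ℝ}
    (ha : Tendsto (fun N : ℕ => chebyshevPartialSum N F 0) atTop (𝓝 a)) :
    Tendsto (fun m : ℕ => (2 * (m : ℝ) + 1) * cosRemainder F m 0) atTop (𝓝 0) := by
  have h0 : (0 : ℝ) ∈ Set.Icc 0 π := ⟨le_rfl, pi_pos.le⟩
  have hs : Tendsto (fun m => sinRemainder F m 0) atTop (𝓝 0) := by
    rw [Metric.tendsto_nhds]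
    intro ε hε
    filter_upwards [eventually_abs_remainder_lt hα hc hF hM hε] with m hm
    rw [dist_zero_right]
    exact (hm 0 h0).1
  have hlim : Tendsto (fun m : ℕ => (2 * (m : ℝ) + 1) * cosRemainder F m 0) atTop
      (𝓝 (0 - π * (a - F 0))) := by
    rw [← tendsto_add_atTop_iff_nat 1]
    refine (((tendsto_add_atTop_iff_nat 1).2 hs).sub
      ((ha.sub_const (F 0)).const_mul π)).congr fun N => ?_
    rw [chebyshevPartialSum_sub hα hc hF hM N h0, cos_zero, U_eval_one, U_eval_one]
    have := pi_ne_zero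
    field_simp
    push_cast
    ring
  obtain ⟨C, hC⟩ := exists_abs_sum_cosRemainder_le hα hc hF hM
  have hL1 := nonpos_of_sum_range_le (fun K => (le_abs_self _).trans (hC K)) hlim
  have hL2 := nonpos_of_sum_range_le (u := fun m => -cosRemainder F m 0) (C := C)
    (fun K => by
      rw [Finset.sum_neg_distrib]
      exact (neg_le_abs _).trans (hC K)) (by simpa using hlim.neg)
  rwa [le_antisymm hL1 (by linarith)] at hlim

/-- Convergence at `θ = 0` makes the convergence uniform up to `θ = 0`. -/
theorem eventually_abs_chebyshevPartialSum_sub_lt (hα : 0 < α) (hc : Continuous F)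
    (hF : ∀ s t, |F s - F t| ≤ M * |s - t| ^ α) (hM : 0 ≤ M) {a : ℝ}
    (ha : Tendsto (fun N : ℕ => chebyshevPartialSum N F 0) atTop (𝓝 a)) {ε : ℝ} (hε : 0 < ε) :
    ∀ᶠ N : ℕ in atTop, ∀ θ ∈ Set.Icc 0 (π / 2), |chebyshevPartialSum N F θ - F θ| < ε := by
  have hr : -1 < α - 1 := by linarith
  have hε' := half_pos hε
  have h1 := eventually_abs_remainder_lt hα hc hF hM hε'
  have h2 := Metric.tendsto_nhds.1 (tendsto_mul_cosRemainder_zero hα hc hF hM ha) _ hε'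
  have h3 := (isWeaklySingular_sin_half hc hF hM).eventually_abs_integral_lt hr hε'
  filter_upwards [(tendsto_add_atTop_nat 1).eventually (h1.and (h2.and h3))] with N hN θ hθ
  obtain ⟨h1, h2, h3⟩ := hN
  have hθ' : θ ∈ Set.Icc 0 π := ⟨hθ.1, by linarith [hθ.2, pi_pos]⟩
  replace h1 := (h1 θ hθ').1
  replace h3 := (h3 θ hθ').2
  rw [dist_zero_right, norm_eq_abs, abs_mul, abs_of_pos (by positivity)] at h2
  rw [chebyshevPartialSum_sub hα hc hF hM N hθ', cosRemainder_eq hα hc hF hM N.succ_ne_zero hθ']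
  have hWm := cos_half_mul_chebyshevU_sub (N + 1) θ
  have hWp := sin_half_mul_chebyshevU_add (N + 1) θ
  have hWp' := abs_chebyshevU_add_le (N + 1) θ
  set Wm := (U ℝ (N + 1 : ℕ)).eval (cos θ) - (U ℝ (((N + 1 : ℕ) : ℤ) - 1)).eval (cos θ)
  set Wp := (U ℝ (N + 1 : ℕ)).eval (cos θ) + (U ℝ (((N + 1 : ℕ) : ℤ) - 1)).eval (cos θ)
  set k := ∫ t in (0)..π, (F t - F θ) * (sin (θ / 2) * cos (t / 2)) / (cos θ - cos t) *
        cos (((N + 1 : ℕ) + 1 / 2) * t)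
  have hcos : 1 / 2 ≤ cos (θ / 2) := by
    rw [← cos_pi_div_three]
    exact cos_le_cos_of_nonneg_of_le_pi (by linarith [hθ.1]) (by linarith [pi_pos])
      (by linarith [hθ.2, pi_pos])
  have b1 : |Wm| ≤ 2 := by
    have := abs_cos_le_one (((N + 1 : ℕ) + 1 / 2) * θ)
    rw [← hWm, abs_mul, abs_of_pos (by linarith)] at this
    nlinarith [abs_nonneg Wm]
  have t1 : |Wm * sinRemainder F (N + 1) θ| ≤ 2 * (ε / 2) := by
    rw [abs_mul]
    gcongr
  have t2 : |Wp * cosRemainder F (N + 1) 0| ≤ ε / 2 := by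
    rw [abs_mul]
    exact (mul_le_mul_of_nonneg_right hWp' (abs_nonneg _)).trans h2.le
  have t3 : |Wp * (2 * sin (θ / 2) * k)| ≤ 2 * (ε / 2) := by
    have : Wp * (2 * sin (θ / 2) * k) = 2 * (sin (((N + 1 : ℕ) + 1 / 2) * θ) * k) := by
      rw [← hWp]
      ring
    rw [this, abs_mul, abs_mul, abs_two]
    gcongr
    exact (mul_le_of_le_one_left (abs_nonneg _) (abs_sin_le_one _)).trans h3.le
  rw [abs_mul, abs_of_pos (by positivity), one_div_mul_eq_div, div_lt_iff₀ pi_pos]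
  calc |Wm * sinRemainder F (N + 1) θ -
        Wp * (cosRemainder F (N + 1) 0 + 2 * sin (θ / 2) * k)|
      = |Wm * sinRemainder F (N + 1) θ - (Wp * cosRemainder F (N + 1) 0 +
          Wp * (2 * sin (θ / 2) * k))| := by rw [mul_add]
    _ ≤ |Wm * sinRemainder F (N + 1) θ| + (|Wp * cosRemainder F (N + 1) 0| +
          |Wp * (2 * sin (θ / 2) * k)|) :=
        (abs_sub _ _).trans (by gcongr; exact abs_add_le _ _)
    _ ≤ 2 * (ε / 2) + (ε / 2 + 2 * (ε / 2)) := by gcongr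
    _ < ε * π := by nlinarith [pi_gt_three]

end

/-! ### Hölder continuous central functions -/

namespace SU2

theorem continuous_su2Dist_left (x : SU2) : Continuous fun y => su2Dist x y := by
  unfold su2Dist
  have : Continuous fun y : SU2 => (x : Matrix (Fin 2) (Fin 2) ℂ) - y :=
    continuous_const.sub continuous_subtype_val
  exact Real.continuous_sqrt.comp (continuous_const.mul
    (Complex.continuous_re.comp (Continuous.matrix_trace (this.mul this.star))))

theorem su2Dist_self (x : SU2) : su2Dist x x = 0 := by
  simp [su2Dist]

theorem su2Dist_mul_negOne (x y : SU2) :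
    su2Dist (x * negOne) (y * negOne) = su2Dist x y := by
  have h (z : SU2) : (z * negOne : SU2).1 = -z.1 := by
    change z.1 * -1 = -z.1
    simp
  rw [su2Dist, su2Dist, h, h, ← neg_sub', star_neg, neg_mul_neg]

theorem su2Dist_torus_le (s t : ℝ) : su2Dist (torus s) (torus t) ≤ |s - t| := by
  have hexp (u : ℝ) : Complex.exp (u * Complex.I) = ⟨Real.cos u, Real.sin u⟩ :=
    Complex.ext (Complex.exp_ofReal_mul_I_re u) (Complex.exp_ofReal_mul_I_im u)
  have hexp' (u : ℝ) : Complex.exp (-(u * Complex.I)) = ⟨Real.cos u, -Real.sin u⟩ := by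
    have := hexp (-u)
    rwa [Real.cos_neg, Real.sin_neg, Complex.ofReal_neg, neg_mul] at this
  have h : (((torus s).1 - (torus t).1) * star ((torus s).1 - (torus t).1)).trace.re =
      4 - 4 * Real.cos (s - t) := by
    simp only [torus, hexp, hexp', Matrix.trace_fin_two, Matrix.mul_apply, Fin.sum_univ_two,
      Matrix.star_apply, Matrix.sub_apply, Real.cos_sub]
    simp
    linear_combination 2 * Real.sin_sq_add_cos_sq s + 2 * Real.sin_sq_add_cos_sq t
  rw [su2Dist, h]
  refine Real.sqrt_le_iff.2 ⟨abs_nonneg _, ?_⟩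
  rw [sq_abs]
  linarith [Real.one_sub_sq_div_two_le_cos (x := s - t)]

theorem IsLip.continuous {α : ℝ} (hα : 0 < α) {f : SU2 → ℝ} (hf : IsLip α f) :
    Continuous f := by
  obtain ⟨M, -, hM⟩ := hf
  rw [continuous_iff_continuousAt]
  intro x
  have h : Tendsto (fun y => M * su2Dist x y ^ α) (𝓝 x) (𝓝 0) := by
    have := (((continuous_su2Dist_left x).tendsto x).rpow_const (p := α) (Or.inr hα.le)).const_mul M
    rwa [su2Dist_self, Real.zero_rpow hα.ne', mul_zero] at this
  rw [ContinuousAt, tendsto_iff_dist_tendsto_zero]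
  refine squeeze_zero (fun _ => dist_nonneg) (fun y => ?_) h
  rw [dist_comm]
  exact hM x y

theorem IsLip.holder_torus {α : ℝ} (hα : 0 < α) {f : SU2 → ℝ} (hf : IsLip α f) :
    ∃ M, 0 ≤ M ∧ ∀ s t, |f (torus s) - f (torus t)| ≤ M * |s - t| ^ α := by
  obtain ⟨M, hM0, hM⟩ := hf
  refine ⟨M, hM0.le, fun s t => (hM _ _).trans ?_⟩
  have := su2Dist_torus_le s t
  have h0 : 0 ≤ su2Dist (torus s) (torus t) := Real.sqrt_nonneg _
  gcongr

theorem IsLip.comp_mul_negOne {α : ℝ} {f : SU2 → ℝ} (hf : IsLip α f) :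
    IsLip α fun x => f (x * negOne) := by
  obtain ⟨M, hM0, hM⟩ := hf
  exact ⟨M, hM0, fun x y => (hM _ _).trans_eq (by rw [su2Dist_mul_negOne])⟩

/-- Haar measure charges every nonempty open set, so a continuous function that is central almost
everywhere is central. -/
theorem IsCentral.forall {f : SU2 → ℝ} (hc : IsCentral f) (hf : Continuous f) (x y : SU2) :
    f (y * x * y⁻¹) = f x := by
  have hd : Dense {x : SU2 | ∀ y : SU2, f (y * x * y⁻¹) = f x} := Measure.dense_of_ae hc
  have hcl : IsClosed {x : SU2 | ∀ y : SU2, f (y * x * y⁻¹) = f x} := by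
    simp only [Set.ofPred_forall]
    exact isClosed_iInter fun y => isClosed_eq (by fun_prop) hf
  have hx : x ∈ {x : SU2 | ∀ y : SU2, f (y * x * y⁻¹) = f x} := by
    rw [← hcl.closure_eq]
    exact hd x
  exact hx y

theorem mul_negOne_comm (x : SU2) : x * negOne = negOne * x := by
  apply Subtype.ext
  change x.1 * -1 = -1 * x.1
  simp

theorem mul_negOne_mul_negOne (x : SU2) : x * negOne * negOne = x := by
  apply Subtype.ext
  change x.1 * -1 * -1 = x.1
  simp

theorem halfTrace_mul_negOne (x : SU2) : halfTrace (x * negOne) = -halfTrace x := by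
  have h : (x * negOne : SU2).1 = -x.1 := by
    change x.1 * -1 = -x.1
    simp
  rw [halfTrace, h, Matrix.trace_neg, Complex.neg_re, neg_div, halfTrace]

theorem partialSum_comp_mul_negOne (N : ℕ) (f : SU2 → ℝ) (x : SU2) :
    partialSum N (fun x => f (x * negOne)) x = partialSum N f (x * negOne) := by
  simp only [partialSum, mul_assoc]

theorem torus_zero : torus 0 = 1 := by
  apply Subtype.ext
  change !![_, _; _, _] = (1 : Matrix (Fin 2) (Fin 2) ℂ)
  rw [Matrix.one_fin_two]
  simp

theorem torus_pi : torus Real.pi = negOne := by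
  apply Subtype.ext
  change !![_, _; _, _] = (-1 : Matrix (Fin 2) (Fin 2) ℂ)
  rw [Matrix.one_fin_two]
  simp [Complex.exp_neg]

theorem one_sub_halfTrace_sq_pos {x : SU2} (h1 : x ≠ 1) (h2 : x ≠ negOne) :
    0 < 1 - halfTrace x ^ 2 := by
  obtain ⟨h, θ, hθ, rfl⟩ := exists_conj_torus x
  rw [halfTrace_conj, halfTrace_torus, ← Real.sin_sq]
  refine pow_pos (Real.sin_pos_of_pos_of_lt_pi (hθ.1.lt_of_ne ?_) (hθ.2.lt_of_ne ?_)) 2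
  · rintro rfl
    exact h1 (by rw [torus_zero]; group)
  · rintro rfl
    exact h2 (by rw [torus_pi, mul_negOne_comm]; group)

theorem norm_partialSum_sub {f : SU2 → ℝ} (hf : Continuous f)
    (hc : ∀ x y, f (y * x * y⁻¹) = f x) (N : ℕ) (h : SU2) (θ : ℝ) :
    ‖partialSum N f (h * torus θ * h⁻¹) - (f (h * torus θ * h⁻¹) : ℂ)‖ =
      |chebyshevPartialSum N (fun t => f (torus t)) θ - f (torus θ)| := by
  rw [partialSum_conj_torus N hf hc, hc, ← Complex.ofReal_sub, Complex.norm_real,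
    Real.norm_eq_abs]

/-- Convergence at `e` gives uniform convergence on the half of the group nearer to `e`. -/
theorem eventually_norm_partialSum_sub_lt {α : ℝ} (hα : 0 < α) {f : SU2 → ℝ} (hf : IsLip α f)
    (hc : ∀ x y, f (y * x * y⁻¹) = f x) {a : ℂ}
    (ha : Tendsto (fun N : ℕ => partialSum N f 1) atTop (𝓝 a)) {ε : ℝ} (hε : 0 < ε) :
    ∀ᶠ N : ℕ in atTop, ∀ x : SU2, 0 ≤ halfTrace x → ‖partialSum N f x - (f x : ℂ)‖ < ε := by
  have hcont := hf.continuous hα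
  obtain ⟨M, hM0, hM⟩ := hf.holder_torus hα
  have ha' : Tendsto (fun N : ℕ => chebyshevPartialSum N (fun t => f (torus t)) 0) atTop
      (𝓝 a.re) := by
    refine ((Complex.continuous_re.tendsto a).comp ha).congr fun N => ?_
    have := partialSum_conj_torus N hcont hc 1 0
    rw [torus_zero, one_mul, inv_one, mul_one] at this
    rw [Function.comp_apply, this, Complex.ofReal_re]
  filter_upwards [eventually_abs_chebyshevPartialSum_sub_lt hα (hcont.comp continuous_torus) hM
    hM0 ha' hε] with N hN x hx
  obtain ⟨h, θ, hθ, rfl⟩ := exists_conj_torus x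
  rw [halfTrace_conj, halfTrace_torus] at hx
  rw [norm_partialSum_sub hcont hc]
  refine hN θ ⟨hθ.1, ?_⟩
  by_contra! hlt
  exact hx.not_gt (Real.cos_neg_of_pi_div_two_lt_of_lt hlt (by linarith [hθ.2, Real.pi_pos]))

end SU2

theorem mainTheorem5 (α : ℝ) (hα : α ∈ Set.Ioo (0 : ℝ) 1) (f : SU2 → ℝ)
    (hf : SU2.IsLip α f) (hc : SU2.IsCentral f) :
    (∀ U : Set SU2, IsOpen U → ({1, SU2.negOne} : Set SU2) ⊆ U →
      TendstoUniformlyOn (fun (N : ℕ) (x : SU2) => SU2.partialSum N f x)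
        (fun x => (f x : ℂ)) atTop Uᶜ) ∧
    ((∃ a : ℂ, Tendsto (fun N : ℕ => SU2.partialSum N f 1) atTop (𝓝 a)) →
      (∃ b : ℂ, Tendsto (fun N : ℕ => SU2.partialSum N f SU2.negOne) atTop (𝓝 b)) →
      TendstoUniformly (fun (N : ℕ) (x : SU2) => SU2.partialSum N f x)
        (fun x => (f x : ℂ)) atTop) := by
  have hα0 := hα.1
  have hcont := hf.continuous hα0
  have hc' := hc.forall hcont
  constructor
  · intro U hU hsub
    rw [Metric.tendstoUniformlyOn_iff]
    intro ε hε
    -- On the compact set `Uᶜ` the function `sin² θ = 1 - (tr x / 2)²` is bounded below.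
    obtain ⟨δ, hδ0, hδ⟩ : ∃ δ > 0, ∀ x ∈ Uᶜ, δ ≤ 1 - SU2.halfTrace x ^ 2 :=
      hU.isClosed_compl.isCompact.exists_forall_le'
        (continuous_const.sub (SU2.continuous_halfTrace.pow 2)).continuousOn fun x hx =>
          SU2.one_sub_halfTrace_sq_pos (fun h => hx (hsub (by simp [h])))
            (fun h => hx (hsub (by simp [h])))
    obtain ⟨M, hM0, hM⟩ := hf.holder_torus hα0
    filter_upwards [eventually_sin_mul_abs_lt hα0 (hcont.comp SU2.continuous_torus) hM hM0
      (mul_pos (Real.sqrt_pos.2 hδ0) hε)] with N hN x hx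
    have hδx := hδ x hx
    obtain ⟨h, θ, hθ, rfl⟩ := SU2.exists_conj_torus x
    rw [SU2.halfTrace_conj, SU2.halfTrace_torus, ← Real.sin_sq] at hδx
    rw [dist_comm, dist_eq_norm, SU2.norm_partialSum_sub hcont hc']
    have hsin : Real.sqrt δ ≤ Real.sin θ :=
      Real.sqrt_le_iff.2 ⟨Real.sin_nonneg_of_nonneg_of_le_pi hθ.1 hθ.2, hδx⟩
    refine lt_of_mul_lt_mul_left (lt_of_le_of_lt ?_ (hN θ hθ)) (Real.sqrt_nonneg δ)
    exact mul_le_mul_of_nonneg_right hsin (abs_nonneg _)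
  · rintro ⟨a, ha⟩ ⟨b, hb⟩
    rw [Metric.tendstoUniformly_iff]
    intro ε hε
    -- The half of the group near `-e` is handled by translating `f` by `-e`.
    have hb' : Tendsto (fun N : ℕ => SU2.partialSum N (fun x => f (x * SU2.negOne)) 1) atTop
        (𝓝 b) := by
      simpa only [SU2.partialSum_comp_mul_negOne, one_mul] using hb
    have hcneg (x y : SU2) : f (y * x * y⁻¹ * SU2.negOne) = f (x * SU2.negOne) := by
      rw [← hc' (x * SU2.negOne) y, mul_assoc, SU2.mul_negOne_comm y⁻¹]
      simp only [mul_assoc]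
    filter_upwards [SU2.eventually_norm_partialSum_sub_lt hα0 hf hc' ha hε,
      SU2.eventually_norm_partialSum_sub_lt hα0 hf.comp_mul_negOne hcneg hb' hε] with N h1 h2 x
    rw [dist_comm, dist_eq_norm]
    rcases le_total 0 (SU2.halfTrace x) with h | h
    · exact h1 x h
    · have := h2 (x * SU2.negOne) (by rw [SU2.halfTrace_mul_negOne]; linarith)
      rwa [SU2.partialSum_comp_mul_negOne, SU2.mul_negOne_mul_negOne] at this
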